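/- Let $I$ be the $2\times 2$ identity matrix, $J=\begin{pmatrix}0&-1\\1&0\end{pmatrix}$, $\mathcal N=\mathrm{diag}(1,-1)$, and $r_e(\theta)=(1+e\cos\theta)^{-1}$ for $0\le e<1$. For $\omega\in\mathbb C$ with $|\omega|=1$ and real $\alpha,\beta$, let $$\mathcal A(\alpha,\beta,e)=-\frac{d^2}{d\theta^2}-2J\frac{d}{d\theta}+r_e(\theta)\big((1+\alpha)I+\beta\mathcal N\big),$$ regarded as an operator in $L^2([0,2\pi],\mathbb C^2)$ with domain $$\bar D_2(\omega,2\pi)=\{y\in W^{2,2}([0,2\pi],\mathbb C^2): y(2\pi)=\omega y(0),\ \dot y(2\pi)=\omega\dot y(0)\}.$$ Let $\phi_\omega(\mathcal A)$ (the $\omega$-Morse index) be the number of negative eigenvalues of $\mathcal A$ on this domain, counted with multiplicity. For symmetric operators $S,T$ on this domain write $S<T$ if $T-S$ is positive definite, i.e. $\langle (T-S)y,y\rangle>0$ for all $y\neq 0$ in the domain. **Theorem 4.5.** Let $0\le e_0\le e<1$, $\alpha_0>0$, $\beta_0>0$, $1+\alpha_0-\beta_0>0$, $\alpha>0$, $\beta\ge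 0$. (i) If $$\frac{\beta}{\beta_0}\,\frac{1+e_0}{1+e}<1\quad\text{and}\quad \frac{\beta(e-e_0)}{\beta_0(1+e)}<\alpha-\frac{\beta}{\beta_0}\alpha_0,$$ then for every $\omega\in\mathbb C$ with $|\omega|=1$, on $\bar D_2(\omega,2\pi)$, $$\frac{\beta}{\beta_0}\,\frac{1+e_0}{1+e}\,\mathcal A(\alpha_0,\beta_0,e_0)<\mathcal A(\alpha,\beta,e)\quad\text{and}\quad \phi_\omega(\mathcal A(\alpha,\beta,e))\le\phi_\omega(\mathcal A(\alpha_0,\beta_0,e_0)).$$ (ii) If $$\frac{\beta}{\beta_0}\,\frac{1-e_0}{1-e}>1\quad\text{and}\quad \frac{\beta(e_0-e)}{\beta_0(1-e)}>\alpha-\frac{\beta}{\beta_0}\alpha_0,$$ then for every $\omega\in\mathbb C$ with $|\omega|=1$, on $\bar D_2(\omega,2\pi)$, $$\mathcal A(\alpha,\beta,e)<\frac{\beta}{\beta_0}\,\frac{1-e_0}{1-e}\,\mathcal A(\alpha_0,\beta_0,e_0)\quad\text{and}\quad \phi_\omega(\mathcal A(\alpha,\beta,e))\ge\phi_\omega(\mathcal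 A(\alpha_0,\beta_0,e_0)).$$ -/

import Mathlib

noncomputable section

namespace EllipticRE

open MeasureTheory Set

/-- `ℂ²` with its standard Hermitian inner product. -/
abbrev C2 : Type := EuclideanSpace ℂ (Fin 2)

/-- Lebesgue measure on the interval `[0, 2π]`. -/
abbrev circMeasure : Measure ℝ := volume.restrict (Icc 0 (2 * Real.pi))

/-- The Hilbert space `L²([0, 2π], ℂ²)`. -/
abbrev L2 : Type := Lp C2 2 circMeasure

/-- `y` is an absolutely continuous representative on `[0, 2π]` of the class `u`, and the class `v`
is its derivative: `u = y` almost everywhere and `y(t) = y(0) + ∫₀ᵗ v` for all `t ∈ [0, 2π]`. -/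
structure IsRep (y : ℝ → C2) (u v : L2) : Prop where
  ae_eq : u =ᵐ[circMeasure] y
  eq_integral : ∀ t ∈ Icc (0 : ℝ) (2 * Real.pi), y t = y 0 + ∫ s in (0 : ℝ)..t, v s

/-- `u ∈ W^{2,2}([0, 2π], ℂ²)` with weak derivatives `u' = v`, `u'' = w` in `L²`, and with
`u(2π) = ω u(0)`, `u'(2π) = ω u'(0)` (values of the continuous representatives of `u` and `u'`). -/
def IsJet (ω : ℂ) (u v w : L2) : Prop :=
  ∃ y p : ℝ → C2, IsRep y u v ∧ IsRep p v w ∧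
    y (2 * Real.pi) = ω • y 0 ∧ p (2 * Real.pi) = ω • p 0

theorem L2.intervalIntegrable (v : L2) {t : ℝ} (ht : t ∈ Icc (0 : ℝ) (2 * Real.pi)) :
    IntervalIntegrable (fun s => v s) volume 0 t := by
  have h : Integrable (fun s => v s) circMeasure := (Lp.memLp v).integrable (by norm_num)
  rw [intervalIntegrable_iff_integrableOn_Ioc_of_le ht.1]
  exact IntegrableOn.mono_set h (fun x hx => ⟨hx.1.le, hx.2.trans ht.2⟩)

theorem L2.integral_congr {f : ℝ → C2} {v : L2} (h : v =ᵐ[circMeasure] f) {t : ℝ}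
    (ht : t ∈ Icc (0 : ℝ) (2 * Real.pi)) :
    ∫ s in (0 : ℝ)..t, v s = ∫ s in (0 : ℝ)..t, f s := by
  rw [intervalIntegral.integral_of_le ht.1, intervalIntegral.integral_of_le ht.1]
  refine MeasureTheory.integral_congr_ae ?_
  have hsub : Ioc 0 t ⊆ Icc 0 (2 * Real.pi) := fun x hx => ⟨hx.1.le, hx.2.trans ht.2⟩
  exact ae_restrict_of_ae_restrict_of_subset hsub h

theorem IsRep.add {y y' : ℝ → C2} {u v u' v' : L2} (h : IsRep y u v) (h' : IsRep y' u' v') :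
    IsRep (y + y') (u + u') (v + v') where
  ae_eq := (Lp.coeFn_add u u').trans (h.ae_eq.add h'.ae_eq)
  eq_integral t ht := by
    rw [L2.integral_congr (Lp.coeFn_add v v') ht]
    simp only [Pi.add_apply]
    rw [intervalIntegral.integral_add (L2.intervalIntegrable v ht) (L2.intervalIntegrable v' ht),
      h.eq_integral t ht, h'.eq_integral t ht]
    abel

theorem IsRep.smul {y : ℝ → C2} {u v : L2} (c : ℂ) (h : IsRep y u v) :
    IsRep (c • y) (c • u) (c • v) where
  ae_eq := (Lp.coeFn_smul c u).trans (h.ae_eq.const_smul c)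
  eq_integral t ht := by
    rw [L2.integral_congr (Lp.coeFn_smul c v) ht]
    simp only [Pi.smul_apply]
    rw [intervalIntegral.integral_smul, h.eq_integral t ht, smul_add]

theorem IsRep.continuousOn {y : ℝ → C2} {u v : L2} (h : IsRep y u v) :
    ContinuousOn y (Icc 0 (2 * Real.pi)) := by
  have hpi : (0 : ℝ) ≤ 2 * Real.pi := by positivity
  have h1 : ContinuousOn (fun t => ∫ s in (0 : ℝ)..t, v s) (Icc 0 (2 * Real.pi)) := by
    have h2 := intervalIntegral.continuousOn_primitive_interval (μ := volume)
      (f := fun s => v s) (a := (0 : ℝ)) (b := 2 * Real.pi) (by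
        rw [uIcc_of_le hpi]
        exact (Lp.memLp v).integrable (by norm_num))
    rwa [uIcc_of_le hpi] at h2
  exact (continuousOn_const.add h1).congr h.eq_integral

theorem IsRep.eq_zero {y : ℝ → C2} {v : L2} (h : IsRep y 0 v) : v = 0 := by
  have hpi : (0 : ℝ) < 2 * Real.pi := by positivity
  have hy : EqOn y (fun _ => 0) (Icc 0 (2 * Real.pi)) := by
    refine Measure.eqOn_Icc_of_ae_eq (μ := volume) hpi.ne ?_ h.continuousOn continuousOn_const
    filter_upwards [h.ae_eq, Lp.coeFn_zero C2 2 circMeasure] with x hx hx0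
    rw [← hx, hx0]; rfl
  have hint : ∀ t ∈ Icc (0 : ℝ) (2 * Real.pi), ∫ s in (0 : ℝ)..t, v s = 0 := by
    intro t ht
    have h1 := h.eq_integral t ht
    rw [hy ht, hy (left_mem_Icc.2 hpi.le)] at h1
    simpa using h1.symm
  have hd := (L2.intervalIntegrable v (right_mem_Icc.2 hpi.le)).ae_hasDerivAt_integral
  rw [uIcc_of_le hpi.le] at hd
  rw [Lp.eq_zero_iff_ae_eq_zero]
  change ∀ᵐ x ∂(volume.restrict (Icc 0 (2 * Real.pi))), v x = 0
  rw [← restrict_Ioo_eq_restrict_Icc]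
  filter_upwards [ae_restrict_of_ae hd, ae_restrict_mem measurableSet_Ioo] with x hx hxI
  have h1 := hx (Ioo_subset_Icc_self hxI) 0 (left_mem_Icc.2 hpi.le)
  have h2 : HasDerivAt (fun t => ∫ s in (0 : ℝ)..t, v s) 0 x := by
    refine (hasDerivAt_const x (0 : C2)).congr_of_eventuallyEq ?_
    filter_upwards [Icc_mem_nhds hxI.1 hxI.2] with t ht using hint t ht
  exact h1.unique h2

theorem IsRep.unique {y y' : ℝ → C2} {u v v' : L2} (h : IsRep y u v) (h' : IsRep y' u v') :
    v = v' := by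
  have h1 := h.add (h'.smul (-1))
  have h2 : u + (-1 : ℂ) • u = 0 := by simp
  rw [h2] at h1
  have h3 := h1.eq_zero
  simpa [← sub_eq_add_neg, sub_eq_zero] using h3

theorem IsJet.add {ω : ℂ} {u v w u' v' w' : L2} (h : IsJet ω u v w) (h' : IsJet ω u' v' w') :
    IsJet ω (u + u') (v + v') (w + w') := by
  obtain ⟨y, p, hy, hp, by1, bp⟩ := h
  obtain ⟨y', p', hy', hp', by1', bp'⟩ := h'
  exact ⟨y + y', p + p', hy.add hy', hp.add hp', by simp [by1, by1'], by simp [bp, bp']⟩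

theorem IsJet.smul {ω : ℂ} {u v w : L2} (c : ℂ) (h : IsJet ω u v w) :
    IsJet ω (c • u) (c • v) (c • w) := by
  obtain ⟨y, p, hy, hp, by1, bp⟩ := h
  exact ⟨c • y, c • p, hy.smul c, hp.smul c, by simp [by1, smul_comm c ω],
    by simp [bp, smul_comm c ω]⟩

theorem IsJet.zero (ω : ℂ) : IsJet ω 0 0 0 := by
  have h : IsRep 0 0 0 := ⟨Lp.coeFn_zero C2 2 circMeasure, fun t ht => by
    rw [L2.integral_congr (Lp.coeFn_zero C2 2 circMeasure) ht]; simp⟩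
  exact ⟨0, 0, h, h, by simp, by simp⟩

theorem IsJet.unique {ω : ℂ} {u v w v' w' : L2} (h : IsJet ω u v w) (h' : IsJet ω u v' w') :
    v = v' ∧ w = w' := by
  obtain ⟨y, p, hy, hp, -, -⟩ := h
  obtain ⟨y', p', hy', hp', -, -⟩ := h'
  obtain rfl := hy.unique hy'
  exact ⟨rfl, hp.unique hp'⟩

/-- The domain `{y ∈ W^{2,2}([0, 2π], ℂ²) | y(2π) = ω y(0), y'(2π) = ω y'(0)}`, as a subspace of
`L²([0, 2π], ℂ²)`. -/
def Dbar (ω : ℂ) : Submodule ℂ L2 where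
  carrier := {u | ∃ v w, IsJet ω u v w}
  add_mem' := fun ⟨v, w, h⟩ ⟨v', w', h'⟩ => ⟨v + v', w + w', h.add h'⟩
  zero_mem' := ⟨0, 0, IsJet.zero ω⟩
  smul_mem' := fun c _ ⟨v, w, h⟩ => ⟨c • v, c • w, h.smul c⟩

/-- The weak derivative `y'` of `y ∈ Dbar ω`. -/
def d1 {ω : ℂ} (u : Dbar ω) : L2 := u.2.choose

/-- The second weak derivative `y''` of `y ∈ Dbar ω`. -/
def d2 {ω : ℂ} (u : Dbar ω) : L2 := u.2.choose_spec.choose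

theorem isJet {ω : ℂ} (u : Dbar ω) : IsJet ω u (d1 u) (d2 u) := u.2.choose_spec.choose_spec

theorem d1_add {ω : ℂ} (u u' : Dbar ω) : d1 (u + u') = d1 u + d1 u' :=
  ((isJet (u + u')).unique ((isJet u).add (isJet u'))).1

theorem d2_add {ω : ℂ} (u u' : Dbar ω) : d2 (u + u') = d2 u + d2 u' :=
  ((isJet (u + u')).unique ((isJet u).add (isJet u'))).2

theorem d1_smul {ω : ℂ} (c : ℂ) (u : Dbar ω) : d1 (c • u) = c • d1 u :=
  ((isJet (c • u)).unique ((isJet u).smul c)).1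

theorem d2_smul {ω : ℂ} (c : ℂ) (u : Dbar ω) : d2 (c • u) = c • d2 u :=
  ((isJet (c • u)).unique ((isJet u).smul c)).2

/-- `r_e(θ) = (1 + e cos θ)⁻¹`. -/
def r (e θ : ℝ) : ℝ := (1 + e * Real.cos θ)⁻¹

/-- The matrix `J`. -/
def J : Matrix (Fin 2) (Fin 2) ℂ := !![0, -1; 1, 0]

/-- The matrix `R_{α,β} = (1 + α) I + β diag(1, -1)`. -/
def R (α β : ℝ) : Matrix (Fin 2) (Fin 2) ℂ :=
  ((1 + α : ℝ) : ℂ) • (1 : Matrix (Fin 2) (Fin 2) ℂ) + (β : ℂ) • !![1, 0; 0, -1]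

/-- The pointwise expression `-y'' - 2 J y' + r_e R_{α,β} y`, for given `y`, `y'`, `y''`. -/
def pointwise (α β e : ℝ) (y y' y'' : ℝ → C2) (θ : ℝ) : C2 :=
  -(y'' θ) - (2 : ℂ) • Matrix.toEuclideanCLM (𝕜 := ℂ) J (y' θ)
    + (r e θ : ℂ) • Matrix.toEuclideanCLM (𝕜 := ℂ) (R α β) (y θ)

theorem memLp_pointwise (α β : ℝ) {e : ℝ} (he : e ∈ Ico (0 : ℝ) 1) (u v w : L2) :
    MemLp (pointwise α β e u v w) 2 circMeasure := by
  have hpos : ∀ θ, 0 < 1 + e * Real.cos θ := fun θ => by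
    nlinarith [Real.neg_one_le_cos θ, he.1, he.2]
  have hc : Continuous (r e) := by
    unfold r
    exact Continuous.inv₀ (by fun_prop) (fun θ => (hpos θ).ne')
  have hJ := (Matrix.toEuclideanCLM (𝕜 := ℂ) J).comp_memLp' (Lp.memLp v)
  have hR := (Matrix.toEuclideanCLM (𝕜 := ℂ) (R α β)).comp_memLp' (Lp.memLp u)
  refine ((Lp.memLp w).neg.sub (hJ.const_smul (2 : ℂ))).add ?_
  refine MemLp.of_le_mul (c := (1 - e)⁻¹) hR ?_ (Filter.Eventually.of_forall fun θ => ?_)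
  · exact (Complex.continuous_ofReal.comp hc).aestronglyMeasurable.smul hR.1
  · rw [norm_smul, Complex.norm_real, Real.norm_eq_abs, r, abs_inv, abs_of_pos (hpos θ)]
    refine mul_le_mul_of_nonneg_right (inv_anti₀ (by linarith [he.2]) ?_) (norm_nonneg _)
    nlinarith [Real.neg_one_le_cos θ, he.1]

/-- The operator `𝒜(α, β, e) = -d²/dθ² - 2 J d/dθ + r_e(θ) R_{α,β}` in `L²([0, 2π], ℂ²)`, with domain
`Dbar ω`, for `0 ≤ e < 1`. -/
def A (ω : ℂ) (α β : ℝ) {e : ℝ} (he : e ∈ Ico (0 : ℝ) 1) : Dbar ω →ₗ[ℂ] L2 where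
  toFun u := (memLp_pointwise α β he u (d1 u) (d2 u)).toLp _
  map_add' u u' := by
    rw [← MemLp.toLp_add]
    refine MemLp.toLp_congr _ _ ?_
    rw [d1_add, d2_add]
    filter_upwards [Lp.coeFn_add (u : L2) u', Lp.coeFn_add (d1 u) (d1 u'),
      Lp.coeFn_add (d2 u) (d2 u')] with θ h0 h1 h2
    simp only [pointwise, Submodule.coe_add, Pi.add_apply, h0, h1, h2, map_add, smul_add]
    abel
  map_smul' c u := by
    rw [RingHom.id_apply, ← MemLp.toLp_const_smul]
    refine MemLp.toLp_congr _ _ ?_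
    rw [d1_smul, d2_smul]
    filter_upwards [Lp.coeFn_smul c (u : L2), Lp.coeFn_smul c (d1 u),
      Lp.coeFn_smul c (d2 u)] with θ h0 h1 h2
    simp only [pointwise, Submodule.coe_smul, Pi.smul_apply, h0, h1, h2, map_smul, smul_add,
      smul_sub, smul_neg]
    rw [smul_comm c (2 : ℂ), smul_comm c (r e θ : ℂ)]

/-- `S < T` for operators in `L²` with domain `Dbar ω`: the operator `T - S` is positive definite. -/
def StrictlyLess {ω : ℂ} (S T : Dbar ω →ₗ[ℂ] L2) : Prop :=
  ∀ u : Dbar ω, u ≠ 0 → 0 < (inner ℂ (u : L2) ((T - S) u)).re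

/-- The eigenspace `ker (T - μ)`. -/
def eigenspace {ω : ℂ} (T : Dbar ω →ₗ[ℂ] L2) (μ : ℝ) : Submodule ℂ (Dbar ω) :=
  LinearMap.ker (T - (μ : ℂ) • (Dbar ω).subtype)

/-- The number of negative eigenvalues of `T`, counted with multiplicity: the dimension of the sum
of the eigenspaces to negative eigenvalues (this sum is direct). -/
def morseIndex {ω : ℂ} (T : Dbar ω →ₗ[ℂ] L2) : ℕ∞ :=
  Cardinal.toENat (Module.rank ℂ ↥(⨆ μ : {μ : ℝ // μ < 0}, eigenspace T μ))

end EllipticRE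

end

/-! Both parts rest on one factorisation. Write `g` for the logarithmic derivative of `1 + e cos θ`;
it satisfies the Riccati equation `g' = r_e - 1 - g²`. Integrating by parts (boundary terms cancel
since `|ω| = 1`) turns the form of the Kepler operator `-d² - 2Jd + r_e` into `‖y' + J y - g y‖²`,
so this operator is nonnegative (`re_inner_kepler_nonneg`).

Put `b = β/β₀`, and in part (i) `s = (1+e₀)/(1+e)`. Then `𝒜(α,β,e) - b s 𝒜(α₀,β₀,e₀)` is `1 - b s >
0` times the Kepler operator for `e` plus multiplication by a diagonal matrix function. The
pointwise bound `s r_{e₀} ≤ r_e` shows that both diagonal entries are at least `m r_e ≥ m/2`, where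
`m = α - b α₀ - b(1-s) > 0` is exactly the second hypothesis. Part (ii) is the mirror image, with `s
= (1-e₀)/(1-e)` and the opposite bound `r_e ≤ s r_{e₀}`. This is `le_re_inner_comb`, `form_lt_of_lt`
and `form_lt_of_gt`.

The index inequality is a min-max argument. On the span of its negative eigenvectors a symmetric
operator has negative form, so the comparison makes the other operator's form negative on the same
space. Projecting that space orthogonally onto the negative spectral subspace of the other operator
is injective, provided the form is nonnegative on the orthogonal complement
(`IsResolvent.form_nonneg`, `IsResolvent.toENat_rank_le`). That proviso needs completeness of
eigenvectors, hence a compact resolvent, which is built by hand: `d/dθ ± κ` is inverted explicitly,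
the inverse is compact through the Volterra operator, and the lower-order terms are absorbed by a
Neumann series for large `κ` (`exists_resolvent_deriv`, `exists_isResolvent_A`). -/

noncomputable section

namespace EllipticRE

open scoped InnerProductSpace

/-! ### Negative spectral subspaces of symmetric operators with compact resolvent -/

section Abstract

variable {H : Type*} [NormedAddCommGroup H] [InnerProductSpace ℂ H]

theorem re_inner_sum_smul_of_pairwise_orthogonal {ι : Type*} (s : Finset ι) (x : ι → H) (c : ι → ℝ)
    (h : ∀ i ∈ s, ∀ j ∈ s, i ≠ j → ⟪x i, x j⟫_ℂ = 0) :
    (⟪∑ i ∈ s, x i, ∑ i ∈ s, (c i : ℂ) • x i⟫_ℂ).re = ∑ i ∈ s, c i * ‖x i‖ ^ 2 := by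
  rw [sum_inner, Complex.re_sum]
  refine Finset.sum_congr rfl fun i hi => ?_
  rw [inner_sum, Finset.sum_eq_single i]
  · rw [inner_smul_right, inner_self_eq_norm_sq_to_K, Complex.re_ofReal_mul]
    norm_cast
  · intro j hj hji
    rw [inner_smul_right, h i hi j hj hji.symm, mul_zero]
  · exact fun hi' => absurd hi hi'

variable {D : Submodule ℂ H}

/-- The eigenspace of a linear map defined on a subspace. -/
def eigSpace (T : D →ₗ[ℂ] H) (μ : ℝ) : Submodule ℂ D :=
  LinearMap.ker (T - (μ : ℂ) • D.subtype)

/-- The span of the eigenspaces to negative eigenvalues. -/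
def negSpace (T : D →ₗ[ℂ] H) : Submodule ℂ D :=
  ⨆ μ : {μ : ℝ // μ < 0}, eigSpace T μ

theorem mem_eigSpace {T : D →ₗ[ℂ] H} {μ : ℝ} {u : D} :
    u ∈ eigSpace T μ ↔ T u = (μ : ℂ) • (u : H) := by
  simp [eigSpace, sub_eq_zero]

/-- Symmetry of a linear map defined on a subspace. -/
def IsSymm (T : D →ₗ[ℂ] H) : Prop := ∀ u w : D, ⟪T u, (w : H)⟫_ℂ = ⟪(u : H), T w⟫_ℂ

theorem IsSymm.inner_eq_zero {T : D →ₗ[ℂ] H} (hT : IsSymm T) {μ ν : ℝ} (hne : μ ≠ ν) {u w : D}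
    (hu : u ∈ eigSpace T μ) (hw : w ∈ eigSpace T ν) : ⟪(u : H), (w : H)⟫_ℂ = 0 := by
  have h := hT u w
  rw [mem_eigSpace.1 hu, mem_eigSpace.1 hw, inner_smul_left, inner_smul_right,
    Complex.conj_ofReal] at h
  have h2 : ((μ : ℂ) - ν) * ⟪(u : H), (w : H)⟫_ℂ = 0 := by rw [sub_mul, h, sub_self]
  rcases mul_eq_zero.1 h2 with h3 | h3
  · exact absurd (by exact_mod_cast sub_eq_zero.1 h3) hne
  · exact h3

/-- Eigenspaces to distinct eigenvalues are orthogonal, so on a sum of eigenvectors the form is the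
sum of the negative numbers `μ ‖u_μ‖²`. -/
theorem IsSymm.re_inner_neg {T : D →ₗ[ℂ] H} (hT : IsSymm T) {u : D} (hu : u ∈ negSpace T)
    (hu0 : u ≠ 0) : (⟪(u : H), T u⟫_ℂ).re < 0 := by
  obtain ⟨f, hf, rfl⟩ := (Submodule.mem_iSup_iff_exists_finsupp _ _).1 hu
  have hTf : T (f.sum fun _ x => x) = ∑ i ∈ f.support, ((i : ℝ) : ℂ) • ((f i : D) : H) := by
    rw [Finsupp.sum, map_sum]
    exact Finset.sum_congr rfl fun i _ => mem_eigSpace.1 (hf i)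
  have hcoe : ((f.sum fun _ x => x : D) : H) = ∑ i ∈ f.support, ((f i : D) : H) := by
    rw [Finsupp.sum, Submodule.coe_sum]
  rw [hTf, hcoe, re_inner_sum_smul_of_pairwise_orthogonal]
  · refine Finset.sum_neg (fun i hi => ?_) ?_
    · have h0 : (f i : D) ≠ 0 := Finsupp.mem_support_iff.1 hi
      have h1 : 0 < ‖((f i : D) : H)‖ := norm_pos_iff.2 (by simpa using h0)
      exact mul_neg_of_neg_of_pos i.2 (by positivity)
    · rw [Finsupp.support_nonempty_iff]
      rintro rfl
      exact hu0 (by simp)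
  · intro i _ j _ hij
    exact hT.inner_eq_zero (fun h => hij (Subtype.ext h)) (hf i) (hf j)

/-- `G` is an inverse of `T + K`. -/
def IsResolvent (T : D →ₗ[ℂ] H) (K : ℝ) (G : H →L[ℂ] H) : Prop :=
  ∀ f, ∃ u : D, (u : H) = G f ∧ T u + (K : ℂ) • (u : H) = f

variable {T : D →ₗ[ℂ] H} {K : ℝ} {G : H →L[ℂ] H}

/-- Surjectivity and symmetry give injectivity: `u` itself is hit by some `w`, and moving `T + K`
across the inner product leaves `‖u‖² = 0`. Hence the right inverse `G` is also a left inverse. -/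
theorem IsResolvent.eq_zero (hG : IsResolvent T K G) (hT : IsSymm T) {u : D}
    (hu : T u + (K : ℂ) • (u : H) = 0) : u = 0 := by
  obtain ⟨w, -, hw⟩ := hG (u : H)
  have h1 : ⟪T u + (K : ℂ) • (u : H), (w : H)⟫_ℂ = ⟪(u : H), T w + (K : ℂ) • (w : H)⟫_ℂ := by
    rw [inner_add_left, inner_add_right, hT, inner_smul_left, inner_smul_right,
      Complex.conj_ofReal]
  rw [hu, hw, inner_zero_left] at h1
  simpa using h1.symm

theorem IsResolvent.apply (hG : IsResolvent T K G) (hT : IsSymm T) (u : D) :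
    G (T u + (K : ℂ) • (u : H)) = u := by
  obtain ⟨w, hw, hw'⟩ := hG (T u + (K : ℂ) • (u : H))
  have : w - u = 0 := hG.eq_zero hT (by
    rw [map_sub, Submodule.coe_sub, smul_sub, sub_add_sub_comm, hw', sub_self])
  rw [← hw, sub_eq_zero.1 this]

theorem IsResolvent.isSymmetric (hG : IsResolvent T K G) (hT : IsSymm T) :
    (G : H →ₗ[ℂ] H).IsSymmetric := by
  intro f g
  obtain ⟨u, hu, hu'⟩ := hG f
  obtain ⟨w, hw, hw'⟩ := hG g
  simp only [ContinuousLinearMap.coe_coe]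
  rw [← hu, ← hw, ← hu', ← hw', inner_add_left, inner_add_right, hT, inner_smul_left,
    inner_smul_right, Complex.conj_ofReal]

/-- The orthogonal complement in `H` of the negative spectral subspace. -/
def nonnegSpace (T : D →ₗ[ℂ] H) : Submodule ℂ H := ((negSpace T).map D.subtype)ᗮ

theorem mem_nonnegSpace {x : H} :
    x ∈ nonnegSpace T ↔ ∀ w ∈ negSpace T, ⟪(w : H), x⟫_ℂ = 0 := by
  simp [nonnegSpace, Submodule.mem_orthogonal]

theorem mem_nonnegSpace_iff_eigSpace {x : H} :
    x ∈ nonnegSpace T ↔ ∀ μ : ℝ, μ < 0 → ∀ w ∈ eigSpace T μ, ⟪(w : H), x⟫_ℂ = 0 := by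
  rw [mem_nonnegSpace]
  constructor
  · intro h μ hμ w hw
    exact h w (Submodule.mem_iSup_of_mem (⟨μ, hμ⟩ : {μ : ℝ // μ < 0}) hw)
  · intro h w hw
    refine Submodule.iSup_induction _ (motive := fun w : D => ⟪(w : H), x⟫_ℂ = 0) hw
      (fun μ w hw => h μ μ.2 w hw) (by simp) (fun a b ha hb => ?_)
    simp [ha, hb]

theorem IsResolvent.map_nonnegSpace (hG : IsResolvent T K G) (hT : IsSymm T) {x : H}
    (hx : x ∈ nonnegSpace T) : G x ∈ nonnegSpace T := by
  rw [mem_nonnegSpace_iff_eigSpace] at hx ⊢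
  intro μ hμ w hw
  have h1 := hG.apply hT w
  rw [mem_eigSpace.1 hw, ← add_smul, map_smul] at h1
  have h2 : ⟪G (w : H), x⟫_ℂ = ⟪(w : H), G x⟫_ℂ := hG.isSymmetric hT w x
  -- Nothing prevents `-K` from being the eigenvalue `μ` a priori; in that case `w = G 0 = 0`.
  rcases eq_or_ne ((μ : ℂ) + K) 0 with h0 | h0
  · rw [h0, zero_smul] at h1
    rw [← h1, inner_zero_left]
  · have h3 : ⟪((μ : ℂ) + K) • G (w : H), x⟫_ℂ = 0 := by rw [h1]; exact hx μ hμ w hw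
    rw [inner_smul_left, mul_eq_zero, map_eq_zero] at h3
    rw [← h2]
    exact h3.resolve_left h0

theorem IsSymm.map_nonnegSpace (hT : IsSymm T) {u : D} (hu : (u : H) ∈ nonnegSpace T) :
    T u + (K : ℂ) • (u : H) ∈ nonnegSpace T := by
  refine Submodule.add_mem _ ?_ (Submodule.smul_mem _ _ hu)
  rw [mem_nonnegSpace_iff_eigSpace] at hu ⊢
  intro μ hμ w hw
  rw [← hT, mem_eigSpace.1 hw, inner_smul_left, hu μ hμ w hw, mul_zero]

/-- If `ν ≠ 0`, then `x` is an eigenvector of `T` to `ν⁻¹ - K`, and `ν - K ν² = ν² (ν⁻¹ - K)`. A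
negative value would put `x` in a negative eigenspace, hence make it orthogonal to itself. -/
theorem IsResolvent.eigenvalue_restrict (hG : IsResolvent T K G) {ν : ℝ} {x : H}
    (hx : x ∈ nonnegSpace T) (hx0 : x ≠ 0) (h : G x = (ν : ℂ) • x) : 0 ≤ ν - K * ν ^ 2 := by
  by_contra! hneg
  have hν : ν ≠ 0 := by rintro rfl; simp at hneg
  have hνC : (ν : ℂ) ≠ 0 := by exact_mod_cast hν
  obtain ⟨u, hu, hu'⟩ := hG ((ν : ℂ)⁻¹ • x)
  have hux : (u : H) = x := by rw [hu, map_smul, h, smul_smul, inv_mul_cancel₀ hνC, one_smul]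
  have hmem : u ∈ eigSpace T (ν⁻¹ - K) := by
    rw [mem_eigSpace, eq_sub_of_add_eq hu', hux, ← sub_smul]
    push_cast; rfl
  have hlt : ν⁻¹ - K < 0 := by
    have : ν - K * ν ^ 2 = ν ^ 2 * (ν⁻¹ - K) := by field_simp
    rw [this] at hneg
    exact (pos_iff_neg_of_mul_neg hneg).1 (by positivity)
  have h0 := mem_nonnegSpace_iff_eigSpace.1 hx _ hlt u hmem
  rw [hux] at h0
  exact hx0 (inner_self_eq_zero.1 h0)

variable [CompleteSpace H]

/-- Formally `G - K G² = G T G`, so this is the nonnegativity of the form of `T` written with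
bounded operators only. It can therefore be checked on a dense subspace: the span of the
eigenvectors of the compact symmetric restriction of `G` to the invariant subspace `W`. -/
theorem IsResolvent.re_inner_nonneg (hG : IsResolvent T K G) (hT : IsSymm T)
    (hc : IsCompactOperator G) {x : H} (hx : x ∈ nonnegSpace T) :
    0 ≤ (⟪x, G x - (K : ℂ) • G (G x)⟫_ℂ).re := by
  set W := nonnegSpace T with hW
  have : IsClosed (W : Set H) := Submodule.isClosed_orthogonal _
  have : CompleteSpace W := this.completeSpace_coe
  have hinv : ∀ y ∈ W, (G : H →ₗ[ℂ] H) y ∈ W := fun y hy => hG.map_nonnegSpace hT hy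
  let S : W →L[ℂ] W := G.restrict hinv
  have hSc : IsCompactOperator S := hc.restrict' hinv
  have hSs : S.IsSymmetric := (hG.isSymmetric hT).restrict_invariant hinv
  have hbot := S.orthogonalComplement_iSup_eigenspaces_eq_bot hSc hSs
  set U : Submodule ℂ W := ⨆ μ, Module.End.eigenspace (S : Module.End ℂ W) μ with hU
  have hdense : U.topologicalClosure = ⊤ := U.topologicalClosure_eq_top_iff.2 hbot
  have hcl : IsClosed {y : W | 0 ≤ (⟪y, S y - (K : ℂ) • S (S y)⟫_ℂ).re} :=
    isClosed_le continuous_const (Complex.continuous_re.comp (by fun_prop))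
  have hsub : (U : Set W) ⊆ {y : W | 0 ≤ (⟪y, S y - (K : ℂ) • S (S y)⟫_ℂ).re} := by
    intro y hy
    obtain ⟨f, hf, rfl⟩ := (Submodule.mem_iSup_iff_exists_finsupp _ _).1 hy
    have hev : ∀ i ∈ f.support, ((i.re : ℝ) : ℂ) = i ∧ 0 ≤ i.re - K * i.re ^ 2 := by
      intro i hi
      have hfi : f i ≠ 0 := Finsupp.mem_support_iff.1 hi
      have h1 := hSs.conj_eigenvalue_eq_self
        (Module.End.hasEigenvalue_of_hasEigenvector ⟨hf i, hfi⟩)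
      have h2 : ((i.re : ℝ) : ℂ) = i := Complex.conj_eq_iff_re.1 h1
      refine ⟨h2, hG.eigenvalue_restrict (x := (f i : W)) (f i).2 (by simpa using hfi) ?_⟩
      have h3 := Module.End.mem_eigenspace_iff.1 (hf i)
      rw [h2]
      exact congrArg Subtype.val h3
    have hSf : ∀ i, S (f i) = i • f i := fun i => Module.End.mem_eigenspace_iff.1 (hf i)
    have hsum : S (f.sum fun _ x => x) - (K : ℂ) • S (S (f.sum fun _ x => x)) =
        ∑ i ∈ f.support, ((i.re - K * i.re ^ 2 : ℝ) : ℂ) • f i := by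
      rw [Finsupp.sum]
      simp only [map_sum, hSf, map_smul, Finset.smul_sum, ← Finset.sum_sub_distrib]
      refine Finset.sum_congr rfl fun i hi => ?_
      push_cast
      rw [(hev i hi).1, sub_smul, smul_smul, smul_smul, pow_two, mul_assoc]
    rw [Set.mem_ofPred_eq, hsum, Finsupp.sum, re_inner_sum_smul_of_pairwise_orthogonal]
    · exact Finset.sum_nonneg fun i hi => mul_nonneg (hev i hi).2 (by positivity)
    · intro i _ j _ hij
      exact hSs.orthogonalFamily_eigenspaces hij ⟨f i, hf i⟩ ⟨f j, hf j⟩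
  have hall := hcl.closure_subset_iff.2 hsub
  have hmem : (⟨x, hx⟩ : W) ∈ closure (U : Set W) := by
    rw [← Submodule.topologicalClosure_coe, hdense]; trivial
  exact hall hmem

/-- The form of an operator with compact resolvent is nonnegative on the orthogonal complement of
its negative spectral subspace. -/
theorem IsResolvent.form_nonneg (hG : IsResolvent T K G) (hT : IsSymm T)
    (hc : IsCompactOperator G) {u : D} (hu : (u : H) ∈ nonnegSpace T) :
    0 ≤ (⟪(u : H), T u⟫_ℂ).re := by
  have h1 := hG.re_inner_nonneg hT hc (hT.map_nonnegSpace (K := K) hu)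
  rw [hG.apply hT] at h1
  -- With `x = (T + K) u` one has `G x = u`, and symmetry of `G` turns the second term into `K ⟪u,
  -- u⟫`, which cancels the shift.
  have h2 : ⟪T u + (K : ℂ) • (u : H), (u : H) - (K : ℂ) • G u⟫_ℂ = ⟪(u : H), T u⟫_ℂ := by
    have hs := hG.isSymmetric hT (T u + (K : ℂ) • (u : H)) u
    simp only [ContinuousLinearMap.coe_coe] at hs
    rw [inner_sub_right, inner_smul_right, ← hs, hG.apply hT, inner_add_left, inner_smul_left,
      Complex.conj_ofReal, hT, add_sub_cancel_right]
  rwa [h2] at h1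

/-- A vector of `V` killed by the orthogonal projection onto the negative spectral subspace has both
nonnegative and negative form unless it is zero, so the projection embeds `V`. If the negative
subspace is infinite-dimensional, the right-hand side is `⊤`. -/
theorem IsResolvent.toENat_rank_le (hG : IsResolvent T K G) (hT : IsSymm T)
    (hc : IsCompactOperator G) (V : Submodule ℂ D)
    (hV : ∀ u ∈ V, u ≠ 0 → (⟪(u : H), T u⟫_ℂ).re < 0) :
    Cardinal.toENat (Module.rank ℂ V) ≤ Cardinal.toENat (Module.rank ℂ (negSpace T)) := by
  rcases lt_or_ge (Module.rank ℂ (negSpace T)) Cardinal.aleph0 with hfin | hinf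
  · have : Module.Finite ℂ (negSpace T) := Module.rank_lt_aleph0_iff.1 hfin
    set N : Submodule ℂ H := (negSpace T).map D.subtype with hN
    have : FiniteDimensional ℂ N := inferInstance
    let P : V →ₗ[ℂ] N := (N.orthogonalProjectionOnto : H →ₗ[ℂ] N) ∘ₗ D.subtype ∘ₗ V.subtype
    have hP : Function.Injective P := by
      rw [← LinearMap.ker_eq_bot, LinearMap.ker_eq_bot']
      intro v hv
      by_contra hv0
      have h1 : ((v : D) : H) ∈ nonnegSpace T :=
        Submodule.orthogonalProjectionOnto_eq_zero_iff.1 hv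
      exact (hG.form_nonneg hT hc h1).not_gt (hV v v.2 (by simpa using hv0))
    exact Cardinal.toENat.monotone'
      ((LinearMap.rank_le_of_injective P hP).trans (rank_map_le D.subtype (negSpace T)))
  · rw [Cardinal.toENat_eq_top.2 hinf]
    exact le_top

end Abstract

end EllipticRE

end

noncomputable section

namespace EllipticRE

open MeasureTheory Set

/-! ### Product rule for primitives of integrable functions -/

section ProductRule

variable {E F G : Type*} [NormedAddCommGroup E] [NormedSpace ℝ E] [NormedAddCommGroup F]
  [NormedSpace ℝ F] [NormedAddCommGroup G] [NormedSpace ℝ G]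

omit [NormedSpace ℝ E] in
theorem absolutelyContinuousOnInterval_of_norm_sub_le {k : ℝ → E} {n : ℝ → ℝ} {T : ℝ} (hT : 0 ≤ T)
    (hn : IntervalIntegrable n volume 0 T)
    (hk : ∀ x ∈ Icc 0 T, ∀ y ∈ Icc 0 T, x ≤ y → ‖k y - k x‖ ≤ ∫ s in x..y, n s) :
    AbsolutelyContinuousOnInterval k 0 T := by
  have hN := hn.absolutelyContinuousOnInterval_intervalIntegral (c := 0) (by simp)
  rw [absolutelyContinuousOnInterval_iff] at hN ⊢
  intro ε hε
  obtain ⟨δ, hδ, h⟩ := hN ε hε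
  refine ⟨δ, hδ, fun I hI hlt => lt_of_le_of_lt (Finset.sum_le_sum fun i hi => ?_) (h I hI hlt)⟩
  obtain ⟨hx, hy⟩ := hI.1 i hi
  rw [uIcc_of_le hT] at hx hy
  have hint : ∀ t ∈ Icc 0 T, IntervalIntegrable n volume 0 t := fun t ht => hn.mono_set (by
    rw [uIcc_of_le hT, uIcc_of_le ht.1]; exact Icc_subset_Icc_right ht.2)
  rcases le_total (I.2 i).1 (I.2 i).2 with hle | hle
  · rw [dist_comm, dist_eq_norm, dist_comm, Real.dist_eq,
      intervalIntegral.integral_interval_sub_left (hint _ hy) (hint _ hx)]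
    exact (hk _ hx _ hy hle).trans (le_abs_self _)
  · rw [dist_eq_norm, Real.dist_eq,
      intervalIntegral.integral_interval_sub_left (hint _ hx) (hint _ hy)]
    exact (hk _ hy _ hx hle).trans (le_abs_self _)

/-- `f` is a primitive of `f'` on `[0, T]`. -/
def IsPrim (T : ℝ) (f f' : ℝ → E) : Prop :=
  IntervalIntegrable f' volume 0 T ∧ ∀ t ∈ Icc 0 T, f t = f 0 + ∫ s in (0 : ℝ)..t, f' s

theorem IsPrim.intervalIntegrable {T : ℝ} {f f' : ℝ → E} (hf : IsPrim T f f') {x y : ℝ}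
    (hx : x ∈ Icc 0 T) (hy : y ∈ Icc 0 T) : IntervalIntegrable f' volume x y :=
  hf.1.mono_set (by
    rw [uIcc_of_le (hx.1.trans hx.2)]
    exact ordConnected_Icc.uIcc_subset hx hy)

theorem IsPrim.sub_eq {T : ℝ} {f f' : ℝ → E} (hf : IsPrim T f f') {x y : ℝ}
    (hx : x ∈ Icc 0 T) (hy : y ∈ Icc 0 T) : f y - f x = ∫ s in x..y, f' s := by
  have h0 : (0 : ℝ) ∈ Icc 0 T := ⟨le_rfl, hx.1.trans hx.2⟩
  rw [hf.2 y hy, hf.2 x hx, add_sub_add_left_eq_sub, intervalIntegral.integral_interval_sub_left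
    (hf.intervalIntegrable h0 hy) (hf.intervalIntegrable h0 hx)]

theorem IsPrim.continuousOn {T : ℝ} {f f' : ℝ → E} (hT : 0 ≤ T) (hf : IsPrim T f f') :
    ContinuousOn f (Icc 0 T) := by
  have h2 := intervalIntegral.continuousOn_primitive_interval' hf.1 (left_mem_uIcc)
  rw [uIcc_of_le hT] at h2
  exact (continuousOn_const.add h2).congr hf.2

theorem IsPrim.ae_hasDerivAt [CompleteSpace E] {T : ℝ} {f f' : ℝ → E} (hT : 0 ≤ T)
    (hf : IsPrim T f f') : ∀ᵐ x, x ∈ Ioo 0 T → HasDerivAt f (f' x) x := by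
  filter_upwards [hf.1.ae_hasDerivAt_integral] with x hx hxI
  rw [uIcc_of_le hT] at hx
  have h1 := (hx (Ioo_subset_Icc_self hxI) 0 (left_mem_Icc.2 hT)).const_add (f 0)
  refine h1.congr_of_eventuallyEq ?_
  filter_upwards [Icc_mem_nhds hxI.1 hxI.2] with t ht using hf.2 t ht

theorem IsPrim.of_hasDerivAt [CompleteSpace E] {f f' : ℝ → E} (hf : ∀ x, HasDerivAt f (f' x) x)
    (hc : Continuous f') (T : ℝ) : IsPrim T f f' :=
  ⟨hc.intervalIntegrable _ _, fun t _ => by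
    rw [intervalIntegral.integral_eq_sub_of_hasDerivAt (fun x _ => hf x)
      (hc.intervalIntegrable _ _), add_sub_cancel]⟩

/-- The difference `k` between `b (f, h)` and the integral of the expected derivative is absolutely
continuous with derivative zero almost everywhere, hence constant. Absolute continuity follows by
dominating the increments of `k` by integrals of one integrable function. -/
theorem IsPrim.bilin [CompleteSpace E] [CompleteSpace F] [CompleteSpace G] {T : ℝ} (hT : 0 ≤ T)
    {f f' : ℝ → E} {h h' : ℝ → F} {b : E × F → G} (hb : IsBoundedBilinearMap ℝ b)
    (hf : IsPrim T f f') (hh : IsPrim T h h') :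
    IsPrim T (fun t => b (f t, h t)) (fun t => b (f' t, h t) + b (f t, h' t)) := by
  obtain ⟨C, hC, hbound⟩ := hb.bound
  obtain ⟨Cf, hCf⟩ := isCompact_Icc.exists_bound_of_continuousOn (hf.continuousOn hT)
  obtain ⟨Ch, hCh⟩ := isCompact_Icc.exists_bound_of_continuousOn (hh.continuousOn hT)
  have hsub : Ioc 0 T ⊆ Icc 0 T := Ioc_subset_Icc_self
  have hfm : AEStronglyMeasurable f (volume.restrict (Ioc 0 T)) :=
    ((hf.continuousOn hT).mono hsub).aestronglyMeasurable measurableSet_Ioc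
  have hhm : AEStronglyMeasurable h (volume.restrict (Ioc 0 T)) :=
    ((hh.continuousOn hT).mono hsub).aestronglyMeasurable measurableSet_Ioc
  have hfi := (intervalIntegrable_iff_integrableOn_Ioc_of_le hT).1 hf.1
  have hhi := (intervalIntegrable_iff_integrableOn_Ioc_of_le hT).1 hh.1
  have hm1 : IntervalIntegrable (fun t => b (f' t, h t)) volume 0 T := by
    rw [intervalIntegrable_iff_integrableOn_Ioc_of_le hT]
    refine Integrable.mono' (hfi.norm.const_mul (C * Ch))
      (hb.continuous.comp_aestronglyMeasurable (hfi.1.prodMk hhm)) ?_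
    filter_upwards [ae_restrict_mem measurableSet_Ioc] with t ht
    calc ‖b (f' t, h t)‖ ≤ C * ‖f' t‖ * ‖h t‖ := hbound _ _
      _ ≤ C * ‖f' t‖ * Ch := by gcongr; exact hCh t (hsub ht)
      _ = C * Ch * ‖f' t‖ := by ring
  have hm2 : IntervalIntegrable (fun t => b (f t, h' t)) volume 0 T := by
    rw [intervalIntegrable_iff_integrableOn_Ioc_of_le hT]
    refine Integrable.mono' (hhi.norm.const_mul (C * Cf))
      (hb.continuous.comp_aestronglyMeasurable (hfm.prodMk hhi.1)) ?_
    filter_upwards [ae_restrict_mem measurableSet_Ioc] with t ht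
    calc ‖b (f t, h' t)‖ ≤ C * ‖f t‖ * ‖h' t‖ := hbound _ _
      _ ≤ C * Cf * ‖h' t‖ := by gcongr; exact hCf t (hsub ht)
  set m : ℝ → G := fun t => b (f' t, h t) + b (f t, h' t) with hm
  have hmi : IntervalIntegrable m volume 0 T := hm1.add hm2
  refine ⟨hmi, ?_⟩
  have hsubI : ∀ x ∈ Icc 0 T, ∀ y ∈ Icc 0 T, uIcc x y ⊆ uIcc 0 T := fun x hx y hy => by
    rw [uIcc_of_le hT]; exact ordConnected_Icc.uIcc_subset hx hy
  have h0 : (0 : ℝ) ∈ Icc 0 T := left_mem_Icc.2 hT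
  set k : ℝ → G := fun t => b (f t, h t) - ∫ s in (0 : ℝ)..t, m s with hk
  have hac : AbsolutelyContinuousOnInterval k 0 T := by
    refine absolutelyContinuousOnInterval_of_norm_sub_le hT
      (n := fun s => (C * Ch * ‖f' s‖ + C * Cf * ‖h' s‖) + ‖m s‖)
      (((hf.1.norm.const_mul _).add (hh.1.norm.const_mul _)).add hmi.norm) fun x hx y hy hxy => ?_
    have i1 : IntervalIntegrable (fun s => C * Ch * ‖f' s‖) volume x y :=
      (hf.intervalIntegrable hx hy).norm.const_mul _
    have i2 : IntervalIntegrable (fun s => C * Cf * ‖h' s‖) volume x y :=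
      (hh.intervalIntegrable hx hy).norm.const_mul _
    have i3 : IntervalIntegrable m volume x y := hmi.mono_set (hsubI x hx y hy)
    rw [intervalIntegral.integral_add (i1.add i2) i3.norm, intervalIntegral.integral_add i1 i2,
      intervalIntegral.integral_const_mul, intervalIntegral.integral_const_mul]
    have hkk : k y - k x = b (f y - f x, h y) + b (f x, h y - h x) - ∫ s in x..y, m s := by
      rw [← intervalIntegral.integral_interval_sub_left (hmi.mono_set (hsubI 0 h0 y hy))
        (hmi.mono_set (hsubI 0 h0 x hx)), hb.map_sub_left, hb.map_sub_right]
      simp only [hk]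
      abel
    rw [hkk]
    refine (norm_sub_le _ _).trans (add_le_add ((norm_add_le _ _).trans (add_le_add ?_ ?_)) ?_)
    · have hfxy : ‖f y - f x‖ ≤ ∫ s in x..y, ‖f' s‖ := by
        rw [hf.sub_eq hx hy]; exact intervalIntegral.norm_integral_le_integral_norm hxy
      have hCh' := hCh y hy
      calc _ ≤ C * ‖f y - f x‖ * ‖h y‖ := hbound _ _
        _ ≤ C * (∫ s in x..y, ‖f' s‖) * Ch := by
          have := (norm_nonneg _).trans hfxy
          gcongr
        _ = _ := by ring
    · have : ‖h y - h x‖ ≤ ∫ s in x..y, ‖h' s‖ := by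
        rw [hh.sub_eq hx hy]; exact intervalIntegral.norm_integral_le_integral_norm hxy
      have hCf' := hCf x hx
      have := (norm_nonneg _).trans hCf'
      calc _ ≤ C * ‖f x‖ * ‖h y - h x‖ := hbound _ _
        _ ≤ C * Cf * (∫ s in x..y, ‖h' s‖) := by gcongr
    · exact intervalIntegral.norm_integral_le_integral_norm hxy
  have hder : ∀ᵐ x, x ∈ uIcc 0 T → HasDerivAt k 0 x := by
    have e0 : ∀ᵐ x : ℝ, x ≠ 0 := by simp [ae_iff, measure_singleton]
    have eT : ∀ᵐ x : ℝ, x ≠ T := by simp [ae_iff, measure_singleton]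
    filter_upwards [e0, eT, hf.ae_hasDerivAt hT, hh.ae_hasDerivAt hT, hmi.ae_hasDerivAt_integral]
      with x hx0 hxT hxf hxh hxm hxI
    have hxI' := hxI
    rw [uIcc_of_le hT] at hxI'
    have hxo : x ∈ Ioo 0 T := ⟨lt_of_le_of_ne hxI'.1 hx0.symm, lt_of_le_of_ne hxI'.2 hxT⟩
    have d1 := (hb.hasFDerivAt (f x, h x)).comp_hasDerivAt x ((hxf hxo).prodMk (hxh hxo))
    have d2 := d1.sub (hxm hxI 0 (by simp))
    have h3 : hb.deriv (f x, h x) (f' x, h' x) - m x = 0 := by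
      rw [sub_eq_zero, hb.deriv_apply, add_comm]
    rw [h3] at d2
    exact d2
  obtain ⟨c, hc⟩ := hac.const_of_ae_hasDerivAt_zero hder
  intro t ht
  have h1 := hc t (by rwa [uIcc_of_le hT])
  have h2 := hc 0 (by simp)
  rw [← h2] at h1
  simp only [hk, intervalIntegral.integral_same, sub_zero] at h1
  exact sub_eq_iff_eq_add.1 h1

end ProductRule

end EllipticRE

end

noncomputable section

namespace EllipticRE

open MeasureTheory Set
open scoped InnerProductSpace

/-! ### Quasi-periodic integration by parts and multiplication operators -/

/-- First-order quasi-periodic jets: `u ∈ W^{1,2}` with derivative `v` and `u(2π) = ω u(0)`. -/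
def IsQuasi (ω : ℂ) (u v : L2) : Prop :=
  ∃ y : ℝ → C2, IsRep y u v ∧ y (2 * Real.pi) = ω • y 0

theorem two_pi_nonneg : (0 : ℝ) ≤ 2 * Real.pi := by positivity

theorem isJet_iff {ω : ℂ} {u v w : L2} : IsJet ω u v w ↔ IsQuasi ω u v ∧ IsQuasi ω v w :=
  ⟨fun ⟨y, p, hy, hp, by1, bp⟩ => ⟨⟨y, hy, by1⟩, ⟨p, hp, bp⟩⟩,
    fun ⟨⟨y, hy, by1⟩, ⟨p, hp, bp⟩⟩ => ⟨y, p, hy, hp, by1, bp⟩⟩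

theorem IsQuasi.add {ω : ℂ} {u v u' v' : L2} (h : IsQuasi ω u v) (h' : IsQuasi ω u' v') :
    IsQuasi ω (u + u') (v + v') := by
  obtain ⟨y, hy, b⟩ := h
  obtain ⟨y', hy', b'⟩ := h'
  exact ⟨y + y', hy.add hy', by simp [b, b']⟩

theorem IsQuasi.smul {ω : ℂ} {u v : L2} (c : ℂ) (h : IsQuasi ω u v) :
    IsQuasi ω (c • u) (c • v) := by
  obtain ⟨y, hy, b⟩ := h
  exact ⟨c • y, hy.smul c, by simp [b, smul_comm c ω]⟩

theorem IsRep.isPrim {y : ℝ → C2} {u v : L2} (h : IsRep y u v) :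
    IsPrim (2 * Real.pi) y v :=
  ⟨L2.intervalIntegrable v (right_mem_Icc.2 two_pi_nonneg), h.eq_integral⟩

theorem integral_circMeasure {E : Type*} [NormedAddCommGroup E] [NormedSpace ℝ E] (f : ℝ → E) :
    ∫ θ, f θ ∂circMeasure = ∫ θ in (0 : ℝ)..2 * Real.pi, f θ := by
  rw [intervalIntegral.integral_of_le two_pi_nonneg, integral_Icc_eq_integral_Ioc]

/-- Integration by parts: the boundary term at `2π` is `conj ω * ω = 1` times the one at `0`, so the
two cancel. -/
theorem IsQuasi.inner_add_inner {ω : ℂ} (hω : ‖ω‖ = 1) {u v a b : L2} (h : IsQuasi ω u v)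
    (h' : IsQuasi ω a b) : ⟪v, a⟫_ℂ + ⟪u, b⟫_ℂ = 0 := by
  obtain ⟨y, hy, hyb⟩ := h
  obtain ⟨p, hp, hpb⟩ := h'
  have hb : IsBoundedBilinearMap ℝ fun q : C2 × C2 => ⟪q.1, q.2⟫_ℂ := isBoundedBilinearMap_inner
  have h1 := (IsPrim.bilin two_pi_nonneg hb hy.isPrim hp.isPrim).2 _ (right_mem_Icc.2 two_pi_nonneg)
  simp only [hyb, hpb, inner_smul_left, inner_smul_right] at h1
  have h2 : (starRingEnd ℂ) ω * ω = 1 := by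
    rw [mul_comm, Complex.mul_conj, Complex.normSq_eq_norm_sq, hω]; simp
  rw [← mul_assoc, mul_comm ω, h2, one_mul, left_eq_add] at h1
  rw [L2.inner_def, L2.inner_def, ← integral_add (L2.integrable_inner v a)
    (L2.integrable_inner u b), ← h1, ← integral_circMeasure]
  refine integral_congr_ae ?_
  filter_upwards [hy.ae_eq, hp.ae_eq] with θ h3 h4
  rw [h3, h4]

section Multiplication

variable {M : ℝ → C2 →L[ℂ] C2}

theorem memLp_mul (hM : Continuous M) (u : L2) : MemLp (fun θ => M θ (u θ)) 2 circMeasure := by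
  obtain ⟨C, hC⟩ := isCompact_Icc.exists_bound_of_continuousOn
    (s := Icc 0 (2 * Real.pi)) hM.continuousOn
  refine MemLp.of_le_mul (c := C) (Lp.memLp u) ?_ ?_
  · exact isBoundedBilinearMap_apply.continuous.comp_aestronglyMeasurable
      (hM.aestronglyMeasurable.prodMk (Lp.memLp u).1)
  · filter_upwards [ae_restrict_mem measurableSet_Icc] with θ hθ
    exact (M θ).le_of_opNorm_le (hC θ hθ) _

theorem norm_toLp_mul_le {C : ℝ} (hC : ∀ θ ∈ Icc 0 (2 * Real.pi), ‖M θ‖ ≤ C) (hM : Continuous M)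
    (u : L2) : ‖(memLp_mul hM u).toLp _‖ ≤ C * ‖u‖ := by
  refine Lp.norm_le_mul_norm_of_ae_le_mul ?_
  filter_upwards [(memLp_mul hM u).coeFn_toLp, ae_restrict_mem measurableSet_Icc] with θ h hθ
  rw [h]
  exact (M θ).le_of_opNorm_le (hC θ hθ) _

/-- Multiplication by a continuous operator-valued function, as an operator on `L²`. -/
def mulL (M : ℝ → C2 →L[ℂ] C2) (hM : Continuous M) : L2 →L[ℂ] L2 :=
  LinearMap.mkContinuousOfExistsBound
    { toFun := fun u => (memLp_mul hM u).toLp _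
      map_add' := fun u v => by
        rw [← MemLp.toLp_add]
        refine MemLp.toLp_congr _ _ ?_
        filter_upwards [Lp.coeFn_add u v] with θ h
        rw [h, Pi.add_apply, map_add, Pi.add_apply]
      map_smul' := fun c u => by
        rw [RingHom.id_apply, ← MemLp.toLp_const_smul]
        refine MemLp.toLp_congr _ _ ?_
        filter_upwards [Lp.coeFn_smul c u] with θ h
        rw [h, Pi.smul_apply, map_smul, Pi.smul_apply] }
    (by
      obtain ⟨C, hC⟩ := isCompact_Icc.exists_bound_of_continuousOn
        (s := Icc 0 (2 * Real.pi)) hM.continuousOn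
      exact ⟨C, norm_toLp_mul_le hC hM⟩)

theorem mulL_ae (hM : Continuous M) (u : L2) :
    mulL M hM u =ᵐ[circMeasure] fun θ => M θ (u θ) :=
  (memLp_mul hM u).coeFn_toLp

theorem inner_mulL_right (hM : Continuous M) (u v : L2) :
    ⟪u, mulL M hM v⟫_ℂ = ∫ θ, ⟪u θ, M θ (v θ)⟫_ℂ ∂circMeasure := by
  rw [L2.inner_def]
  refine integral_congr_ae ?_
  filter_upwards [mulL_ae hM v] with θ h
  rw [h]

theorem inner_mulL_left (hM : Continuous M) (u v : L2) :
    ⟪mulL M hM u, v⟫_ℂ = ∫ θ, ⟪M θ (u θ), v θ⟫_ℂ ∂circMeasure := by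
  rw [L2.inner_def]
  refine integral_congr_ae ?_
  filter_upwards [mulL_ae hM u] with θ h
  rw [h]

theorem inner_mulL_comm (hM : Continuous M) (h : ∀ θ x y, ⟪M θ x, y⟫_ℂ = ⟪x, M θ y⟫_ℂ) (u v : L2) :
    ⟪mulL M hM u, v⟫_ℂ = ⟪u, mulL M hM v⟫_ℂ := by
  rw [inner_mulL_left, inner_mulL_right]
  simp_rw [h]

theorem re_inner_mulL_ge (hM : Continuous M) {δ : ℝ}
    (h : ∀ θ x, δ * ‖x‖ ^ 2 ≤ (⟪x, M θ x⟫_ℂ).re) (u : L2) :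
    δ * ‖u‖ ^ 2 ≤ (⟪u, mulL M hM u⟫_ℂ).re := by
  have h1 : ‖u‖ ^ 2 = (⟪u, u⟫_ℂ).re := by
    rw [inner_self_eq_norm_sq_to_K]; norm_cast
  have hi : Integrable (fun θ => ⟪u θ, M θ (u θ)⟫_ℂ) circMeasure := by
    refine (L2.integrable_inner u (mulL M hM u)).congr ?_
    filter_upwards [mulL_ae hM u] with θ h
    rw [h]
  rw [h1, inner_mulL_right, L2.inner_def]
  have e1 := integral_re hi
  have e2 := integral_re (L2.integrable_inner (𝕜 := ℂ) u u)
  simp only [RCLike.re_to_complex] at e1 e2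
  rw [← e1, ← e2, ← integral_const_mul]
  refine integral_mono_ae ((L2.integrable_inner (𝕜 := ℂ) u u).re.const_mul δ) hi.re
    (Filter.Eventually.of_forall fun θ => ?_)
  have h2 : (⟪u θ, u θ⟫_ℂ).re = ‖u θ‖ ^ 2 := by rw [inner_self_eq_norm_sq_to_K]; norm_cast
  change δ * (⟪u θ, u θ⟫_ℂ).re ≤ _
  rw [h2]
  exact h θ (u θ)

/-- Multiplication by a continuous scalar function. -/
def scal (g : ℝ → ℝ) (hg : Continuous g) : L2 →L[ℂ] L2 :=
  mulL (fun θ => (g θ : ℂ) • ContinuousLinearMap.id ℂ C2) (by fun_prop)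

theorem scal_ae {g : ℝ → ℝ} (hg : Continuous g) (u : L2) :
    scal g hg u =ᵐ[circMeasure] fun θ => (g θ : ℂ) • u θ := by
  filter_upwards [mulL_ae (M := fun θ => (g θ : ℂ) • ContinuousLinearMap.id ℂ C2)
    (by fun_prop) u] with θ h
  exact h

theorem inner_scal_comm {g : ℝ → ℝ} (hg : Continuous g) (u v : L2) :
    ⟪scal g hg u, v⟫_ℂ = ⟪u, scal g hg v⟫_ℂ := by
  refine inner_mulL_comm _ (fun θ x y => ?_) u v
  simp

theorem IsQuasi.scal {ω : ℂ} {u v : L2} (h : IsQuasi ω u v) {g g' : ℝ → ℝ}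
    (hg : ∀ x, HasDerivAt g (g' x) x) (hc : Continuous g) (hc' : Continuous g')
    (hper : g (2 * Real.pi) = g 0) :
    IsQuasi ω (scal g hc u) (scal g' hc' u + scal g hc v) := by
  obtain ⟨y, hy, hb⟩ := h
  have hbil : IsBoundedBilinearMap ℝ fun p : ℝ × C2 => p.1 • p.2 := isBoundedBilinearMap_smul
  have hp := IsPrim.bilin two_pi_nonneg hbil (IsPrim.of_hasDerivAt hg hc' _) hy.isPrim
  refine ⟨fun t => g t • y t, ⟨?_, fun t ht => ?_⟩, ?_⟩
  · filter_upwards [scal_ae hc u, hy.ae_eq] with θ h1 h2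
    rw [h1, h2]; rfl
  · refine (hp.2 t ht).trans ?_
    congr 1
    refine (L2.integral_congr ?_ ht).symm
    filter_upwards [scal_ae hc v, scal_ae hc' u, hy.ae_eq,
      Lp.coeFn_add (EllipticRE.scal g' hc' u) (EllipticRE.scal g hc v)] with θ h1 h2 h3 h4
    rw [h4, Pi.add_apply, h1, h2, h3]; rfl
  · simp only [hper, hb]
    rw [smul_comm]

end Multiplication

end EllipticRE

end

noncomputable section

namespace EllipticRE

open MeasureTheory Set
open scoped InnerProductSpace BoundedContinuousFunction

/-! ### Compactness of the Volterra operator -/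

section Volterra

/-- Cauchy–Schwarz; it makes primitives of the `L²` unit ball uniformly bounded and uniformly Hölder
of exponent `1/2`. -/
theorem norm_integral_le_sqrt_mul (f : L2) {s t : ℝ} (hs : s ∈ Icc 0 (2 * Real.pi))
    (ht : t ∈ Icc 0 (2 * Real.pi)) (hst : s ≤ t) :
    ‖∫ x in s..t, f x‖ ≤ ‖f‖ * √(t - s) := by
  rw [intervalIntegral.integral_of_le hst]
  have hsub : Ioc s t ⊆ Icc 0 (2 * Real.pi) := fun x hx =>
    ⟨hs.1.trans hx.1.le, hx.2.trans ht.2⟩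
  have hle : volume.restrict (Ioc s t) ≤ circMeasure := Measure.restrict_mono hsub le_rfl
  have hm : AEStronglyMeasurable f (volume.restrict (Ioc s t)) := (Lp.memLp f).1.mono_measure hle
  have h1 : ‖∫ x in Ioc s t, f x‖ₑ ≤ eLpNorm f 2 circMeasure * ENNReal.ofReal √(t - s) := by
    calc ‖∫ x in Ioc s t, f x‖ₑ ≤ ∫⁻ x in Ioc s t, ‖f x‖ₑ := enorm_integral_le_lintegral_enorm _
      _ = eLpNorm f 1 (volume.restrict (Ioc s t)) := eLpNorm_one_eq_lintegral_enorm.symm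
      _ ≤ eLpNorm f 2 (volume.restrict (Ioc s t)) *
          (volume.restrict (Ioc s t)) univ ^ (1 / (1 : ENNReal).toReal - 1 / (2 : ENNReal).toReal) :=
        eLpNorm_le_eLpNorm_mul_rpow_measure_univ (by norm_num) hm
      _ ≤ eLpNorm f 2 circMeasure * ENNReal.ofReal √(t - s) := by
        refine mul_le_mul' (eLpNorm_mono_measure _ hle) (le_of_eq ?_)
        rw [Measure.restrict_apply_univ, Real.volume_Ioc, Real.sqrt_eq_rpow,
          ENNReal.ofReal_rpow_of_nonneg (sub_nonneg.2 hst) (by norm_num)]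
        norm_num
  have h2 := ENNReal.toReal_mono (by
    exact ENNReal.mul_ne_top (Lp.eLpNorm_ne_top f) ENNReal.ofReal_ne_top) h1
  rwa [ENNReal.toReal_mul, ENNReal.toReal_ofReal (Real.sqrt_nonneg _), toReal_enorm,
    ← Lp.norm_def] at h2

theorem continuousOn_primitive (f : L2) :
    ContinuousOn (fun t => ∫ s in (0 : ℝ)..t, f s) (Icc 0 (2 * Real.pi)) := by
  have h2 := intervalIntegral.continuousOn_primitive_interval'
    (L2.intervalIntegrable f (right_mem_Icc.2 two_pi_nonneg)) left_mem_uIcc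
  rwa [uIcc_of_le two_pi_nonneg] at h2

/-- The primitive of an `L²` function, as a continuous function on `[0, 2π]`. -/
def primC (f : L2) : Icc 0 (2 * Real.pi) →ᵇ C2 :=
  BoundedContinuousFunction.mkOfCompact
    ⟨fun t => ∫ s in (0 : ℝ)..t, f s, (continuousOn_primitive f).domRestrict⟩

/-- Continuous functions on `[0, 2π]` as elements of `L²`. -/
def ofCont (φ : Icc 0 (2 * Real.pi) →ᵇ C2) : L2 :=
  BoundedContinuousFunction.toLp (E := C2) 2 circMeasure ℂ
    (φ.compContinuous ⟨projIcc 0 (2 * Real.pi) two_pi_nonneg, continuous_projIcc⟩)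

theorem continuous_ofCont : Continuous ofCont :=
  (BoundedContinuousFunction.toLp (E := C2) 2 circMeasure ℂ).continuous.comp
    (BoundedContinuousFunction.continuous_compContinuous _)

theorem ofCont_primC_ae (f : L2) :
    ofCont (primC f) =ᵐ[circMeasure] fun t => ∫ s in (0 : ℝ)..t, f s := by
  filter_upwards [BoundedContinuousFunction.coeFn_toLp (p := 2) (𝕜 := ℂ) circMeasure
    ((primC f).compContinuous ⟨projIcc 0 (2 * Real.pi) two_pi_nonneg, continuous_projIcc⟩),
    ae_restrict_mem measurableSet_Icc] with t h ht
  rw [ofCont, h]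
  simp [primC, projIcc_of_mem two_pi_nonneg ht]
  rfl

/-- The Volterra operator `f ↦ ∫₀ᵗ f` as a linear map. -/
def volterraLinear : L2 →ₗ[ℂ] L2 where
  toFun f := ofCont (primC f)
  map_add' f g := by
    refine Lp.ext ?_
    filter_upwards [ofCont_primC_ae f, ofCont_primC_ae g, ofCont_primC_ae (f + g),
      Lp.coeFn_add (ofCont (primC f)) (ofCont (primC g)), ae_restrict_mem measurableSet_Icc]
      with t h1 h2 h3 h4 ht
    rw [h3, h4, Pi.add_apply, h1, h2, L2.integral_congr (Lp.coeFn_add f g) ht]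
    exact intervalIntegral.integral_add (L2.intervalIntegrable f ht) (L2.intervalIntegrable g ht)
  map_smul' c f := by
    refine Lp.ext ?_
    filter_upwards [ofCont_primC_ae f, ofCont_primC_ae (c • f),
      Lp.coeFn_smul c (ofCont (primC f)), ae_restrict_mem measurableSet_Icc] with t h1 h2 h3 ht
    rw [RingHom.id_apply, h2, h3, Pi.smul_apply, h1, L2.integral_congr (Lp.coeFn_smul c f) ht]
    simp only [Pi.smul_apply]
    exact intervalIntegral.integral_smul c (fun s => f s)

/-- By Arzelà–Ascoli the primitives of the unit ball are relatively compact in the continuous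
functions, which map continuously into `L²`. -/
theorem isCompactOperator_volterraLinear : IsCompactOperator volterraLinear := by
  rw [isCompactOperator_iff_image_closedBall_subset_compact (volterraLinear : L2 →ₗ[ℂ] L2)
    zero_lt_one]
  refine ⟨ofCont '' closure (primC '' Metric.closedBall 0 1), IsCompact.image ?_ continuous_ofCont,
    ?_⟩
  · refine BoundedContinuousFunction.arzela_ascoli (Metric.closedBall 0 √(2 * Real.pi))
      (isCompact_closedBall _ _) _ ?_ ?_
    · rintro _ t ⟨f, hf, rfl⟩
      have h1 := norm_integral_le_sqrt_mul f (left_mem_Icc.2 two_pi_nonneg) t.2 t.2.1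
      rw [mem_closedBall_zero_iff] at hf ⊢
      calc ‖primC f t‖ ≤ ‖f‖ * √(t - 0) := h1
        _ ≤ 1 * √(2 * Real.pi) := by
          gcongr
          simpa using t.2.2
        _ = _ := one_mul _
    · refine Metric.equicontinuous_of_continuity_modulus (fun d => √d) ?_ _ ?_
      · have := Real.continuous_sqrt.tendsto 0
        rwa [Real.sqrt_zero] at this
      · have key : ∀ f ∈ Metric.closedBall (0 : L2) 1, ∀ s t : Icc 0 (2 * Real.pi), s ≤ t →
            dist (primC f t) (primC f s) ≤ √(dist t s) := by
          intro f hf s t hst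
          rw [mem_closedBall_zero_iff] at hf
          have h1 := norm_integral_le_sqrt_mul f s.2 t.2 hst
          have h2 : primC f t - primC f s = ∫ x in (s : ℝ)..t, f x :=
            intervalIntegral.integral_interval_sub_left (L2.intervalIntegrable f t.2)
              (L2.intervalIntegrable f s.2)
          rw [dist_eq_norm, h2, Subtype.dist_eq, Real.dist_eq,
            abs_of_nonneg (sub_nonneg.2 (Subtype.coe_le_coe.2 hst))]
          exact h1.trans (mul_le_of_le_one_left (Real.sqrt_nonneg _) hf)
        rintro s t ⟨_, f, hf, rfl⟩
        rcases le_total s t with hst | hst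
        · rw [dist_comm, dist_comm s]; exact key f hf s t hst
        · exact key f hf t s hst
  · rintro _ ⟨f, hf, rfl⟩
    exact ⟨primC f, subset_closure ⟨f, hf, rfl⟩, rfl⟩

/-- The Volterra operator `f ↦ ∫₀ᵗ f` on `L²`. -/
def volterra : L2 →L[ℂ] L2 :=
  ContinuousLinearMap.mkOfIsCompactOperator isCompactOperator_volterraLinear

theorem volterra_ae (f : L2) : volterra f =ᵐ[circMeasure] fun t => ∫ s in (0 : ℝ)..t, f s :=
  ofCont_primC_ae f

theorem IsRep.eq_const_add_volterra {y : ℝ → C2} {u v : L2} (h : IsRep y u v) :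
    u = Lp.constL 2 circMeasure ℂ (y 0) + volterra v := by
  refine Lp.ext ?_
  filter_upwards [h.ae_eq, volterra_ae v, Lp.coeFn_const (p := 2) (μ := circMeasure) (y 0),
    Lp.coeFn_add (Lp.constL 2 circMeasure ℂ (y 0)) (volterra v),
    ae_restrict_mem measurableSet_Icc] with t h1 h2 h3 h4 ht
  rw [h1, h4, Pi.add_apply, h2, h.eq_integral t ht]
  congr 1
  exact h3.symm

end Volterra

/-! ### The first-order quasi-periodic problem `u' + κ u = f` -/

section FirstOrder

variable {ω : ℂ}

theorem memLp_of_continuousOn {y : ℝ → C2} (hy : ContinuousOn y (Icc 0 (2 * Real.pi))) :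
    MemLp y 2 circMeasure := by
  obtain ⟨C, hC⟩ := isCompact_Icc.exists_bound_of_continuousOn hy
  refine MemLp.of_bound (hy.aestronglyMeasurable measurableSet_Icc) C ?_
  filter_upwards [ae_restrict_mem measurableSet_Icc] with t ht using hC t ht

/-- Variation of constants. The boundary condition fixes the initial value because `|ω| = 1` while
`exp (-κ T) ≠ 1`. -/
theorem exists_isQuasi (hω : ‖ω‖ = 1) {κ : ℝ} (hκ : κ ≠ 0) (f : L2) :
    ∃ u : L2, IsQuasi ω u (f - (κ : ℂ) • u) := by
  have hexp : ∀ c x : ℝ, HasDerivAt (fun t : ℝ => Real.exp (c * t)) (c * Real.exp (c * x)) x := by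
    intro c x
    have := ((hasDerivAt_id x).const_mul c).exp
    simpa [mul_comm] using this
  have hprim : ∀ c T : ℝ, IsPrim T (fun t : ℝ => Real.exp (c * t))
      (fun x => c * Real.exp (c * x)) := fun c T =>
    IsPrim.of_hasDerivAt (hexp c) (by fun_prop) T
  set g : ℝ → C2 := fun s => Real.exp (κ * s) • f s with hg
  have hgi : IntervalIntegrable g volume 0 (2 * Real.pi) :=
    (L2.intervalIntegrable f (right_mem_Icc.2 two_pi_nonneg)).continuousOn_smul
      (by fun_prop : Continuous fun s => Real.exp (κ * s)).continuousOn
  set T := 2 * Real.pi with hT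
  have hden : ω - (Real.exp (-κ * T) : ℂ) ≠ 0 := by
    intro h
    have h1 : ‖ω‖ = Real.exp (-κ * T) := by
      rw [sub_eq_zero.1 h, Complex.norm_real, Real.norm_eq_abs, abs_of_pos (Real.exp_pos _)]
    rw [hω, eq_comm, Real.exp_eq_one_iff] at h1
    have : T ≠ 0 := by positivity
    simp_all
  -- The solution of `ω y0 = exp (-κ T) (y0 + ∫₀ᵀ g)`.
  set y0 : C2 := (ω - (Real.exp (-κ * T) : ℂ))⁻¹ • (Real.exp (-κ * T) : ℂ) •
    ∫ s in (0 : ℝ)..T, g s with hy0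
  have hF : IsPrim T (fun t => y0 + ∫ s in (0 : ℝ)..t, g s) g :=
    ⟨hgi, fun t _ => by simp⟩
  have hbil : IsBoundedBilinearMap ℝ fun p : ℝ × C2 => p.1 • p.2 := isBoundedBilinearMap_smul
  set y : ℝ → C2 := fun t => Real.exp (-κ * t) • (y0 + ∫ s in (0 : ℝ)..t, g s) with hy
  have hyp : IsPrim T y fun t => (-κ * Real.exp (-κ * t)) • (y0 + ∫ s in (0 : ℝ)..t, g s) +
      Real.exp (-κ * t) • g t := IsPrim.bilin two_pi_nonneg hbil (hprim (-κ) T) hF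
  have hmem := memLp_of_continuousOn (hyp.continuousOn two_pi_nonneg)
  refine ⟨hmem.toLp y, y, ⟨hmem.coeFn_toLp, fun t ht => ?_⟩, ?_⟩
  · rw [hyp.2 t ht]
    congr 1
    refine (L2.integral_congr ?_ ht).symm
    filter_upwards [Lp.coeFn_sub f ((κ : ℂ) • hmem.toLp y), Lp.coeFn_smul (κ : ℂ) (hmem.toLp y),
      hmem.coeFn_toLp] with s h1 h2 h3
    have h4 : Real.exp (-κ * s) * Real.exp (κ * s) = 1 := by
      rw [← Real.exp_add]; simp
    have h6 : Real.exp (-κ * s) • g s = f s := by rw [hg, smul_smul, h4, one_smul]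
    have h7 : (-κ * Real.exp (-κ * s)) • (y0 + ∫ t in (0 : ℝ)..s, g t) = -(κ • y s) := by
      rw [hy, neg_mul, neg_smul, mul_smul]
    rw [h1, Pi.sub_apply, h2, Pi.smul_apply, h3, h6, h7, Complex.coe_smul]
    abel
  · have h5 : (ω - (Real.exp (-κ * T) : ℂ)) • y0 =
        (Real.exp (-κ * T) : ℂ) • ∫ s in (0 : ℝ)..T, g s := by
      rw [hy0, smul_smul, mul_inv_cancel₀ hden, one_smul]
    rw [sub_smul, sub_eq_iff_eq_add] at h5
    simp only [hy, mul_zero, Real.exp_zero, one_smul, intervalIntegral.integral_same, add_zero]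
    rw [h5, smul_add, add_comm, Complex.coe_smul, Complex.coe_smul]

/-- Pairing `u' = f - κ u` with `u` gives `κ ‖u‖² = Re ⟪u, f⟫`, since `Re ⟪u', u⟫ = 0` by
quasi-periodicity. -/
theorem IsQuasi.abs_mul_norm_le (hω : ‖ω‖ = 1) {κ : ℝ} {u f : L2}
    (h : IsQuasi ω u (f - (κ : ℂ) • u)) : |κ| * ‖u‖ ≤ ‖f‖ := by
  have h1 := h.inner_add_inner hω h
  rw [inner_sub_left, inner_sub_right, inner_smul_left, inner_smul_right, Complex.conj_ofReal,
    inner_self_eq_norm_sq_to_K, ← inner_conj_symm f u] at h1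
  have h2 := congrArg Complex.re h1
  simp only [Complex.add_re, Complex.sub_re, Complex.conj_re, Complex.zero_re] at h2
  have h3 : ((κ : ℂ) * ((‖u‖ : ℝ) : ℂ) ^ 2).re = κ * ‖u‖ ^ 2 := by norm_cast
  have h4 : κ * ‖u‖ ^ 2 = (⟪u, f⟫_ℂ).re := by
    have h3' : ((κ : ℂ) * (RCLike.ofReal ‖u‖ : ℂ) ^ 2).re = κ * ‖u‖ ^ 2 := h3
    rw [h3'] at h2
    linarith
  have h5 : |κ| * ‖u‖ ^ 2 ≤ ‖u‖ * ‖f‖ := by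
    rw [← abs_of_nonneg (sq_nonneg ‖u‖), ← abs_mul, h4]
    exact (Complex.abs_re_le_norm _).trans (norm_inner_le_norm _ _)
  rcases (norm_nonneg u).eq_or_lt with h0 | h0
  · rw [← h0]; simp
  · nlinarith

theorem IsQuasi.eq_of_sub_smul (hω : ‖ω‖ = 1) {κ : ℝ} (hκ : κ ≠ 0) {u u' f : L2}
    (h : IsQuasi ω u (f - (κ : ℂ) • u)) (h' : IsQuasi ω u' (f - (κ : ℂ) • u')) : u = u' := by
  have h1 := h.add (h'.smul (-1))
  have h2 : IsQuasi ω (u + (-1 : ℂ) • u') (0 - (κ : ℂ) • (u + (-1 : ℂ) • u')) := by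
    convert h1 using 1
    module
  have h3 := h2.abs_mul_norm_le hω
  rw [norm_zero] at h3
  have h4 : ‖u + (-1 : ℂ) • u'‖ = 0 :=
    le_antisymm (nonpos_of_mul_nonpos_right h3 (abs_pos.2 hκ)) (norm_nonneg _)
  rw [norm_eq_zero, neg_one_smul, ← sub_eq_add_neg, sub_eq_zero] at h4
  exact h4

/-- The inverse of `d/dθ + κ` with quasi-periodic boundary conditions. -/
theorem exists_resolvent_deriv (hω : ‖ω‖ = 1) {κ : ℝ} (hκ : κ ≠ 0) :
    ∃ S : L2 →L[ℂ] L2, (∀ f, IsQuasi ω (S f) (f - (κ : ℂ) • S f)) ∧ ‖S‖ ≤ |κ|⁻¹ ∧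
      IsCompactOperator S := by
  choose R hR using exists_isQuasi hω hκ
  let S' : L2 →ₗ[ℂ] L2 :=
    { toFun := R
      map_add' := fun f g => by
        refine (hR (f + g)).eq_of_sub_smul hω hκ ?_
        convert (hR f).add (hR g) using 1
        module
      map_smul' := fun c f => by
        refine (hR (c • f)).eq_of_sub_smul hω hκ ?_
        have h := (hR f).smul c
        rwa [smul_sub, smul_comm c (κ : ℂ)] at h }
  have hbound : ∀ f, ‖S' f‖ ≤ |κ|⁻¹ * ‖f‖ := fun f => by
    rw [← div_eq_inv_mul, le_div_iff₀' (abs_pos.2 hκ)]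
    exact (hR f).abs_mul_norm_le hω
  let S : L2 →L[ℂ] L2 := S'.mkContinuous _ hbound
  refine ⟨S, hR, S'.mkContinuous_norm_le (by positivity) hbound, ?_⟩
  -- Since `(S f)' = f - κ S f`, each `S f` is its initial value plus a Volterra integral. Thus `B`
  -- takes values in the constants and has finite rank, while the rest is compact with `volterra`.
  set B : L2 →L[ℂ] L2 := S - volterra ∘L (1 - (κ : ℂ) • S) with hB
  set W : Submodule ℂ L2 := LinearMap.range
    ((Lp.constL 2 circMeasure ℂ : C2 →L[ℂ] L2) : C2 →ₗ[ℂ] L2) with hW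
  have : ProperSpace W := FiniteDimensional.proper ℂ W
  have hBmem : ∀ f, B f ∈ W := by
    intro f
    obtain ⟨y, hy, -⟩ := hR f
    refine ⟨y 0, ?_⟩
    have h := hy.eq_const_add_volterra
    rw [← sub_eq_iff_eq_add] at h
    exact h.symm
  have hBc : IsCompactOperator B := by
    have h1 : IsCompactOperator (B.codRestrict W hBmem) :=
      isCompactOperator_of_locallyCompactSpace_dom (B.codRestrict W hBmem)
    exact h1.clm_comp W.subtypeL
  have hV : IsCompactOperator (volterra ∘L (1 - (κ : ℂ) • S)) :=
    IsCompactOperator.comp_clm (f := volterra) isCompactOperator_volterraLinear _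
  have h3 := hBc.add hV
  have h4 : S = B + volterra ∘L (1 - (κ : ℂ) • S) := by rw [hB, sub_add_cancel]
  rw [h4]
  exact h3

end FirstOrder

end EllipticRE

end

noncomputable section

namespace EllipticRE

open MeasureTheory Set
open scoped InnerProductSpace

/-! ### Symmetry of the operator and positivity of the Kepler operator -/

theorem r_den_pos {e : ℝ} (he : e ∈ Ico (0 : ℝ) 1) (θ : ℝ) : 0 < 1 + e * Real.cos θ := by
  nlinarith [Real.neg_one_le_cos θ, he.1, he.2]

theorem continuous_r {e : ℝ} (he : e ∈ Ico (0 : ℝ) 1) : Continuous (r e) := by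
  unfold r
  exact Continuous.inv₀ (by fun_prop) (fun θ => (r_den_pos he θ).ne')

/-- Multiplication by the matrix `J`. -/
def opJ : L2 →L[ℂ] L2 :=
  mulL (fun _ => Matrix.toEuclideanCLM (𝕜 := ℂ) J) continuous_const

theorem continuous_potential (α β : ℝ) {e : ℝ} (he : e ∈ Ico (0 : ℝ) 1) :
    Continuous fun θ => (r e θ : ℂ) • Matrix.toEuclideanCLM (𝕜 := ℂ) (R α β) :=
  (Complex.continuous_ofReal.comp (continuous_r he)).smul continuous_const

/-- Multiplication by `r_e R_{α,β}`. -/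
def potential (α β : ℝ) {e : ℝ} (he : e ∈ Ico (0 : ℝ) 1) : L2 →L[ℂ] L2 :=
  mulL (fun θ => (r e θ : ℂ) • Matrix.toEuclideanCLM (𝕜 := ℂ) (R α β)) (continuous_potential α β he)

theorem A_apply {ω : ℂ} (α β : ℝ) {e : ℝ} (he : e ∈ Ico (0 : ℝ) 1) (u : Dbar ω) :
    A ω α β he u = -d2 u - (2 : ℂ) • opJ (d1 u) + potential α β he u := by
  refine Lp.ext ?_
  filter_upwards [(memLp_pointwise α β he u (d1 u) (d2 u)).coeFn_toLp,
    Lp.coeFn_add (-d2 u - (2 : ℂ) • opJ (d1 u)) (potential α β he u),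
    Lp.coeFn_sub (-d2 u) ((2 : ℂ) • opJ (d1 u)), Lp.coeFn_neg (d2 u),
    Lp.coeFn_smul (2 : ℂ) (opJ (d1 u)), mulL_ae (continuous_const) (d1 u),
    mulL_ae (continuous_potential α β he) u] with θ h1 h2 h3 h4 h5 h6 h7
  rw [h2, Pi.add_apply, h3, Pi.sub_apply, h4, h5, Pi.neg_apply, Pi.smul_apply]
  refine h1.trans ?_
  rw [pointwise, opJ, potential, h6, h7]
  rfl

theorem inner_J_left (x y : C2) :
    ⟪Matrix.toEuclideanCLM (𝕜 := ℂ) J x, y⟫_ℂ = -⟪x, Matrix.toEuclideanCLM (𝕜 := ℂ) J y⟫_ℂ := by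
  simp [PiLp.inner_apply, Fin.sum_univ_two, J, Matrix.ofLp_toEuclideanCLM, Matrix.vecHead,
    Matrix.vecTail]

theorem J_J_apply (x : C2) :
    Matrix.toEuclideanCLM (𝕜 := ℂ) J (Matrix.toEuclideanCLM (𝕜 := ℂ) J x) = -x := by
  ext i
  fin_cases i <;> simp [J, Matrix.ofLp_toEuclideanCLM, Matrix.vecHead, Matrix.vecTail]

theorem inner_R_left (α β : ℝ) (x y : C2) :
    ⟪Matrix.toEuclideanCLM (𝕜 := ℂ) (R α β) x, y⟫_ℂ =
      ⟪x, Matrix.toEuclideanCLM (𝕜 := ℂ) (R α β) y⟫_ℂ := by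
  simp [PiLp.inner_apply, Fin.sum_univ_two, R, Matrix.ofLp_toEuclideanCLM, Matrix.vecHead,
    Matrix.vecTail]
  ring

theorem re_inner_R (α β : ℝ) (x : C2) :
    (⟪x, Matrix.toEuclideanCLM (𝕜 := ℂ) (R α β) x⟫_ℂ).re =
      (1 + α + β) * ‖x 0‖ ^ 2 + (1 + α - β) * ‖x 1‖ ^ 2 := by
  have h0 : Matrix.toEuclideanCLM (𝕜 := ℂ) (R α β) x 0 = ((1 + α + β : ℝ) : ℂ) * x 0 := by
    simp [R, Matrix.ofLp_toEuclideanCLM, Matrix.vecHead, Matrix.vecTail]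
    ring
  have h1 : Matrix.toEuclideanCLM (𝕜 := ℂ) (R α β) x 1 = ((1 + α - β : ℝ) : ℂ) * x 1 := by
    simp [R, Matrix.ofLp_toEuclideanCLM, Matrix.vecHead, Matrix.vecTail]
    ring
  rw [PiLp.inner_apply, Fin.sum_univ_two, h0, h1]
  simp only [RCLike.inner_apply, mul_assoc, Complex.mul_conj, Complex.normSq_eq_norm_sq]
  norm_cast

theorem opJ_ae (u : L2) :
    opJ u =ᵐ[circMeasure] fun θ => Matrix.toEuclideanCLM (𝕜 := ℂ) J (u θ) :=
  mulL_ae _ u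

theorem inner_opJ_left (u v : L2) : ⟪opJ u, v⟫_ℂ = -⟪u, opJ v⟫_ℂ := by
  rw [opJ, inner_mulL_left, inner_mulL_right]
  simp_rw [inner_J_left]
  rw [integral_neg]

theorem opJ_opJ (u : L2) : opJ (opJ u) = -u := by
  refine Lp.ext ?_
  filter_upwards [opJ_ae u, opJ_ae (opJ u), Lp.coeFn_neg u] with θ h1 h2 h3
  rw [h3, Pi.neg_apply, h2, h1, J_J_apply]

theorem opJ_scal {g : ℝ → ℝ} (hg : Continuous g) (u : L2) :
    opJ (scal g hg u) = scal g hg (opJ u) := by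
  refine Lp.ext ?_
  filter_upwards [opJ_ae u, opJ_ae (scal g hg u), scal_ae hg u, scal_ae hg (opJ u)]
    with θ h1 h2 h3 h4
  rw [h4, h2, h3, h1, map_smul]

theorem inner_potential_comm (α β : ℝ) {e : ℝ} (he : e ∈ Ico (0 : ℝ) 1) (u v : L2) :
    ⟪potential α β he u, v⟫_ℂ = ⟪u, potential α β he v⟫_ℂ := by
  refine inner_mulL_comm _ (fun θ x y => ?_) u v
  simp only [smul_apply, inner_smul_left, inner_smul_right,
    Complex.conj_ofReal, inner_R_left]

variable {ω : ℂ}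

theorem isSymm_A (hω : ‖ω‖ = 1) (α β : ℝ) {e : ℝ} (he : e ∈ Ico (0 : ℝ) 1) :
    IsSymm (A ω α β he) := by
  intro u w
  obtain ⟨hu, hu'⟩ := isJet_iff.1 (isJet u)
  obtain ⟨hw, hw'⟩ := isJet_iff.1 (isJet w)
  have h1 := hu'.inner_add_inner hω hw
  have h2 := hu.inner_add_inner hω hw'
  -- The constant matrix `J` commutes with the derivative and with multiplication by `ω`, so the
  -- first-order term can also be integrated by parts.
  have hJw : IsQuasi ω (opJ w) (opJ (d1 w)) := by
    obtain ⟨y, hy, hb⟩ := hw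
    refine ⟨fun t => Matrix.toEuclideanCLM (𝕜 := ℂ) J (y t), ⟨?_, fun t ht => ?_⟩, ?_⟩
    · filter_upwards [opJ_ae (w : L2), hy.ae_eq] with θ h1 h2
      rw [h1, h2]
    · rw [hy.eq_integral t ht, map_add, L2.integral_congr (opJ_ae (d1 w)) ht,
        ContinuousLinearMap.intervalIntegral_comp_comm _ (L2.intervalIntegrable _ ht)]
    · simp only [hb, map_smul]
  have h3 := hu.inner_add_inner hω hJw
  rw [A_apply, A_apply]
  simp only [inner_add_left, inner_sub_left, inner_neg_left, inner_add_right, inner_sub_right,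
    inner_neg_right, inner_smul_left, inner_smul_right, inner_opJ_left, inner_potential_comm,
    map_ofNat]
  linear_combination h2 - h1 + 2 * h3

/-- The derivative of `log (1 + e cos θ)`. -/
def logDer (e θ : ℝ) : ℝ := -(e * Real.sin θ) * r e θ

theorem continuous_logDer {e : ℝ} (he : e ∈ Ico (0 : ℝ) 1) : Continuous (logDer e) := by
  have := continuous_r he
  unfold logDer
  fun_prop

/-- This Riccati equation is what makes the Kepler operator factor. -/
theorem hasDerivAt_logDer {e : ℝ} (he : e ∈ Ico (0 : ℝ) 1) (θ : ℝ) :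
    HasDerivAt (logDer e) (r e θ - 1 - logDer e θ ^ 2) θ := by
  have hne := (r_den_pos he θ).ne'
  have h1 : HasDerivAt (fun θ => 1 + e * Real.cos θ) (e * -Real.sin θ) θ :=
    ((Real.hasDerivAt_cos θ).const_mul e).const_add 1
  have h2 := ((Real.hasDerivAt_sin θ).const_mul e).neg.mul (h1.inv hne)
  refine h2.congr_deriv ?_
  simp only [logDer, r, Pi.inv_apply, Pi.neg_apply]
  field_simp
  ring

/-- The Kepler operator `-d² - 2 J d + r_e` is nonnegative. -/
theorem re_inner_kepler_nonneg (hω : ‖ω‖ = 1) {e : ℝ} (he : e ∈ Ico (0 : ℝ) 1) {u v w : L2}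
    (h1 : IsQuasi ω u v) (h2 : IsQuasi ω v w) :
    0 ≤ (⟪u, -w - (2 : ℂ) • opJ v + scal (r e) (continuous_r he) u⟫_ℂ).re := by
  set G := scal (logDer e) (continuous_logDer he) with hG
  have hc : Continuous fun θ => r e θ - 1 - logDer e θ ^ 2 := by
    have := continuous_r he
    have := continuous_logDer he
    fun_prop
  have hGq := h1.scal (hasDerivAt_logDer he) (continuous_logDer he) hc (by simp [logDer])
  rw [← hG] at hGq
  have i1 := h1.inner_add_inner hω h2
  have i2 := h1.inner_add_inner hω hGq
  have hid : scal _ hc u = scal (r e) (continuous_r he) u - u - G (G u) := by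
    refine Lp.ext ?_
    filter_upwards [scal_ae hc u, scal_ae (continuous_r he) u, scal_ae (continuous_logDer he) u,
      scal_ae (continuous_logDer he) (G u),
      Lp.coeFn_sub (scal (r e) (continuous_r he) u - u) (G (G u)),
      Lp.coeFn_sub (scal (r e) (continuous_r he) u) u] with θ a1 a2 a3 a4 a5 a6
    rw [a5, Pi.sub_apply, a6, Pi.sub_apply, a1, a2, a4, a3]
    push_cast
    module
  rw [hid] at i2
  -- This square is the Kepler form: `i1` handles `-u''`, `i2` with the Riccati equation turns the
  -- cross term of `v` and `G u` into the potential, and the cross term of `opJ u` and `G u` has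
  -- zero real part.
  have hsq : 0 ≤ (⟪v + opJ u - G u, v + opJ u - G u⟫_ℂ).re := inner_self_nonneg (𝕜 := ℂ)
  have c1 : ⟪opJ u, opJ u⟫_ℂ = ⟪u, u⟫_ℂ := by rw [inner_opJ_left, opJ_opJ, inner_neg_right, neg_neg]
  have c2 : ⟪G u, G u⟫_ℂ = ⟪u, G (G u)⟫_ℂ := inner_scal_comm _ _ _
  have c3 : ⟪u, G v⟫_ℂ = ⟪G u, v⟫_ℂ := (inner_scal_comm _ _ _).symm
  have c4 : ⟪u, opJ v⟫_ℂ = -⟪opJ u, v⟫_ℂ := by rw [inner_opJ_left, neg_neg]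
  have c5 : ⟪opJ u, G u⟫_ℂ = -⟪G u, opJ u⟫_ℂ := by
    rw [inner_opJ_left, opJ_scal, ← inner_scal_comm]
  have s1 : (⟪v, opJ u⟫_ℂ).re = (⟪opJ u, v⟫_ℂ).re := by
    rw [← inner_conj_symm, Complex.conj_re]
  have s2 : (⟪v, G u⟫_ℂ).re = (⟪G u, v⟫_ℂ).re := by
    rw [← inner_conj_symm, Complex.conj_re]
  have i1' := congrArg Complex.re i1
  have i2' := congrArg Complex.re i2
  have c5' := congrArg Complex.re c5
  have h2' : ((2 : ℂ) * ⟪opJ u, v⟫_ℂ).re = 2 * (⟪opJ u, v⟫_ℂ).re := by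
    rw [Complex.mul_re]; simp
  simp only [inner_add_left, inner_sub_left, inner_add_right, inner_sub_right, inner_neg_right,
    inner_smul_right, c1, c2, c3, c4, Complex.add_re, Complex.sub_re, Complex.neg_re, s1, s2, h2',
    mul_neg, Complex.zero_re] at *
  linarith

end EllipticRE

end

noncomputable section

namespace EllipticRE

open MeasureTheory Set
open scoped InnerProductSpace

variable {ω : ℂ}

/-! ### Compact resolvent, form comparison and index comparison -/

/-- For large `κ` the operator plus `κ²` is a small relative perturbation of `-d² + κ² = -(d - κ)(d
+ κ)`, whose inverse is compact. -/
theorem exists_isResolvent_A (hω : ‖ω‖ = 1) (α β : ℝ) {e : ℝ} (he : e ∈ Ico (0 : ℝ) 1) :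
    ∃ (K : ℝ) (G : L2 →L[ℂ] L2), IsResolvent (A ω α β he) K G ∧ IsCompactOperator G := by
  set P := potential α β he with hP
  -- Chosen so that `‖E‖ ≤ (4 ‖opJ‖ + ‖P‖) / κ < 1` below.
  set κ : ℝ := 4 * ‖opJ‖ + ‖P‖ + 1 with hκ
  have hκ1 : 1 ≤ κ := by
    have := norm_nonneg opJ
    have := norm_nonneg P
    linarith
  have hκ0 : 0 < κ := by linarith
  obtain ⟨S, hS, hSn, hSc⟩ := exists_resolvent_deriv hω hκ0.ne'
  obtain ⟨S', hS', hSn', -⟩ := exists_resolvent_deriv hω (neg_ne_zero.2 hκ0.ne')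
  rw [abs_neg] at hSn'
  rw [abs_of_pos hκ0] at hSn hSn'
  -- `Q` inverts `-d² + κ²`, and `Q₁` is `d ∘ Q`.
  set Q : L2 →L[ℂ] L2 := -(S ∘L S') with hQ
  set Q₁ : L2 →L[ℂ] L2 := -S' - (κ : ℂ) • Q with hQ₁
  have hjet : ∀ h, IsJet ω (Q h) (Q₁ h) (((κ ^ 2 : ℝ) : ℂ) • Q h - h) := by
    intro h
    have ha : IsQuasi ω (-S' h) (-h + (κ : ℂ) • -S' h) := by
      convert (hS' h).smul (-1) using 1
      · module
      · push_cast; module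
    have hu : IsQuasi ω (Q h) (Q₁ h) := by
      have hQS : Q h = S (-S' h) := (map_neg S (S' h)).symm
      have hQ₁S : Q₁ h = -S' h - (κ : ℂ) • S (-S' h) := by rw [← hQS]; rfl
      rw [hQS, hQ₁S]
      exact hS (-S' h)
    refine isJet_iff.2 ⟨hu, ?_⟩
    convert ha.add (hu.smul (-κ)) using 1
    · simp only [hQ₁, sub_apply, neg_apply, smul_apply]; module
    · simp only [hQ₁, sub_apply, neg_apply, smul_apply]; push_cast; module
  have hQn : ‖Q‖ ≤ κ⁻¹ * κ⁻¹ := by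
    rw [hQ, norm_neg]
    exact (S.opNorm_comp_le S').trans (mul_le_mul hSn hSn' (norm_nonneg _) (by positivity))
  have hQ₁n : ‖Q₁‖ ≤ 2 * κ⁻¹ := by
    calc ‖Q₁‖ ≤ ‖-S'‖ + ‖(κ : ℂ) • Q‖ := norm_sub_le _ _
      _ ≤ κ⁻¹ + κ * (κ⁻¹ * κ⁻¹) := by
        rw [norm_neg, norm_smul, Complex.norm_real, Real.norm_eq_abs, abs_of_pos hκ0]
        gcongr
      _ = 2 * κ⁻¹ := by field_simp; norm_num
  -- On the range of `Q`, the shifted operator acts by `(𝒜 + κ²) Q = 1 - E`, so the resolvent is `Q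
  -- (1 - E)⁻¹`.
  set E : L2 →L[ℂ] L2 := (2 : ℂ) • (opJ ∘L Q₁) - P ∘L Q with hE
  have hEn : ‖E‖ < 1 := by
    have hinv : κ⁻¹ ≤ 1 := inv_le_one_of_one_le₀ hκ1
    calc ‖E‖ ≤ ‖(2 : ℂ) • (opJ ∘L Q₁)‖ + ‖P ∘L Q‖ := norm_sub_le _ _
      _ ≤ 2 * (‖opJ‖ * (2 * κ⁻¹)) + ‖P‖ * (1 * κ⁻¹) := by
        rw [norm_smul, Complex.norm_ofNat]
        gcongr
        · exact (opJ.opNorm_comp_le Q₁).trans (by gcongr)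
        · exact (P.opNorm_comp_le Q).trans (by gcongr; exact hQn.trans (by gcongr))
      _ = (4 * ‖opJ‖ + ‖P‖) * κ⁻¹ := by ring
      _ < 1 := by
        rw [← div_eq_mul_inv, div_lt_one hκ0, hκ]
        linarith
  let U := Units.oneSub E hEn
  have hU : ∀ f, (U⁻¹ : (L2 →L[ℂ] L2)ˣ).1 f - E ((U⁻¹ : (L2 →L[ℂ] L2)ˣ).1 f) = f := by
    intro f
    have h1 : (U : L2 →L[ℂ] L2) * (U⁻¹ : (L2 →L[ℂ] L2)ˣ).1 = 1 := U.mul_inv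
    exact congrArg (fun B : L2 →L[ℂ] L2 => B f) h1
  refine ⟨κ ^ 2, Q ∘L (U⁻¹ : (L2 →L[ℂ] L2)ˣ).1, fun f => ?_, ?_⟩
  · set h := (U⁻¹ : (L2 →L[ℂ] L2)ˣ).1 f with hh
    refine ⟨⟨Q h, _, _, hjet h⟩, rfl, ?_⟩
    obtain ⟨e1, e2⟩ := (isJet (⟨Q h, _, _, hjet h⟩ : Dbar ω)).unique (hjet h)
    rw [A_apply, e1, e2]
    refine Eq.trans ?_ (hU f)
    rw [← hh, hE]
    simp only [sub_apply, smul_apply, ContinuousLinearMap.comp_apply]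
    module
  · have hQc : IsCompactOperator Q := by
      have h1 : IsCompactOperator (-(S ∘L S')) := (hSc.comp_clm S').neg
      exact h1
    exact hQc.comp_clm _

/-- The derivative terms of `a 𝒜₁ - b 𝒜₂` are `a - b ≥ 0` times those of a Kepler operator.
Splitting that operator off leaves a diagonal multiplication operator, whose two entries are bounded
below by `hp` and `hm`. -/
theorem le_re_inner_comb (hω : ‖ω‖ = 1) {a b δ α₁ β₁ e₁ α₂ β₂ e₂ e₃ : ℝ} (hab : b ≤ a)
    (he₁ : e₁ ∈ Ico (0 : ℝ) 1) (he₂ : e₂ ∈ Ico (0 : ℝ) 1) (he₃ : e₃ ∈ Ico (0 : ℝ) 1)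
    (hp : ∀ θ, δ ≤ a * (r e₁ θ * (1 + α₁ + β₁)) - b * (r e₂ θ * (1 + α₂ + β₂)) - (a - b) * r e₃ θ)
    (hm : ∀ θ, δ ≤ a * (r e₁ θ * (1 + α₁ - β₁)) - b * (r e₂ θ * (1 + α₂ - β₂)) - (a - b) * r e₃ θ)
    (u : Dbar ω) :
    δ * ‖(u : L2)‖ ^ 2 ≤ a * (⟪(u : L2), A ω α₁ β₁ he₁ u⟫_ℂ).re -
      b * (⟪(u : L2), A ω α₂ β₂ he₂ u⟫_ℂ).re := by
  obtain ⟨h1, h2⟩ := isJet_iff.1 (isJet u)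
  have hk := mul_nonneg (sub_nonneg.2 hab) (re_inner_kepler_nonneg hω he₃ h1 h2)
  have hMc : Continuous fun θ =>
      (a : ℂ) • ((r e₁ θ : ℂ) • Matrix.toEuclideanCLM (𝕜 := ℂ) (R α₁ β₁)) -
      (b : ℂ) • ((r e₂ θ : ℂ) • Matrix.toEuclideanCLM (𝕜 := ℂ) (R α₂ β₂)) -
      ((a - b : ℝ) : ℂ) • ((r e₃ θ : ℂ) • ContinuousLinearMap.id ℂ C2) := by
    have := continuous_potential α₁ β₁ he₁
    have := continuous_potential α₂ β₂ he₂
    have := continuous_r he₃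
    fun_prop
  have hM : mulL _ hMc u = (a : ℂ) • potential α₁ β₁ he₁ u - (b : ℂ) • potential α₂ β₂ he₂ u -
      ((a - b : ℝ) : ℂ) • scal (r e₃) (continuous_r he₃) u := by
    refine Lp.ext ?_
    filter_upwards [mulL_ae hMc u, mulL_ae (continuous_potential α₁ β₁ he₁) u,
      mulL_ae (continuous_potential α₂ β₂ he₂) u, scal_ae (continuous_r he₃) u,
      Lp.coeFn_sub ((a : ℂ) • potential α₁ β₁ he₁ (u : L2) - (b : ℂ) • potential α₂ β₂ he₂ u)
        (((a - b : ℝ) : ℂ) • scal (r e₃) (continuous_r he₃) u),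
      Lp.coeFn_sub ((a : ℂ) • potential α₁ β₁ he₁ (u : L2)) ((b : ℂ) • potential α₂ β₂ he₂ u),
      Lp.coeFn_smul (a : ℂ) (potential α₁ β₁ he₁ (u : L2)),
      Lp.coeFn_smul (b : ℂ) (potential α₂ β₂ he₂ (u : L2)),
      Lp.coeFn_smul ((a - b : ℝ) : ℂ) (scal (r e₃) (continuous_r he₃) (u : L2))]
      with θ k1 k2 k3 k4 k5 k6 k7 k8 k9
    rw [k5, Pi.sub_apply, k6, Pi.sub_apply, k7, k8, k9, k1]
    simp only [Pi.smul_apply]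
    rw [k4, potential, k2, potential, k3]
    rfl
  have hform := re_inner_mulL_ge hMc (δ := δ) (fun θ x => by
    have hx : ‖x‖ ^ 2 = ‖x 0‖ ^ 2 + ‖x 1‖ ^ 2 := by
      rw [EuclideanSpace.norm_sq_eq, Fin.sum_univ_two]
    have hxx : (⟪x, x⟫_ℂ).re = ‖x 0‖ ^ 2 + ‖x 1‖ ^ 2 := by
      rw [← hx, inner_self_eq_norm_sq_to_K]; norm_cast
    simp only [sub_apply, smul_apply, ContinuousLinearMap.id_apply, inner_sub_right,
      inner_smul_right, Complex.sub_re, Complex.re_ofReal_mul, re_inner_R, hxx]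
    rw [hx]
    have := mul_le_mul_of_nonneg_right (hp θ) (sq_nonneg ‖x 0‖)
    have := mul_le_mul_of_nonneg_right (hm θ) (sq_nonneg ‖x 1‖)
    linarith) (u : L2)
  rw [hM] at hform
  rw [A_apply, A_apply]
  simp only [inner_sub_right, inner_add_right, inner_smul_right, inner_neg_right, Complex.sub_re,
    Complex.add_re, Complex.neg_re, Complex.re_ofReal_mul] at hform hk ⊢
  linarith

theorem half_le_r {e : ℝ} (he : e ∈ Ico (0 : ℝ) 1) (θ : ℝ) : 1 / 2 ≤ r e θ := by
  rw [r, one_div]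
  refine inv_anti₀ (r_den_pos he θ) ?_
  nlinarith [Real.cos_le_one θ, he.1, he.2]

/-- After clearing denominators the gap is `(e - e₀)(1 - cos θ)`, so equality occurs at `θ = 0`. -/
theorem mul_r_le_r {e e₀ : ℝ} (he : e ∈ Ico (0 : ℝ) 1) (he₀ : e₀ ∈ Ico (0 : ℝ) 1) (hle : e₀ ≤ e)
    (θ : ℝ) : (1 + e₀) / (1 + e) * r e₀ θ ≤ r e θ := by
  have h1 := r_den_pos he θ
  have h2 := r_den_pos he₀ θ
  have h3 : 0 < 1 + e := by linarith [he.1]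
  rw [r, r, ← div_eq_mul_inv, div_div, inv_eq_one_div, div_le_div_iff₀ (by positivity) h1]
  nlinarith [mul_nonneg (sub_nonneg.2 hle) (sub_nonneg.2 (Real.cos_le_one θ))]

/-- Here the gap is `(e - e₀)(1 + cos θ)`, so equality occurs at `θ = π`. -/
theorem r_le_mul_r {e e₀ : ℝ} (he : e ∈ Ico (0 : ℝ) 1) (he₀ : e₀ ∈ Ico (0 : ℝ) 1) (hle : e₀ ≤ e)
    (θ : ℝ) : r e θ ≤ (1 - e₀) / (1 - e) * r e₀ θ := by
  have h1 := r_den_pos he θ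
  have h2 := r_den_pos he₀ θ
  have h3 : 0 < 1 - e := by linarith [he.2]
  rw [r, r, ← div_eq_mul_inv, div_div, inv_eq_one_div, div_le_div_iff₀ h1 (by positivity)]
  nlinarith [mul_nonneg (sub_nonneg.2 hle) (neg_le_iff_add_nonneg'.1 (Real.neg_one_le_cos θ))]

theorem form_lt_of_lt {α β e α₀ β₀ e₀ : ℝ} (hω : ‖ω‖ = 1)
    (he : e ∈ Ico (0 : ℝ) 1) (he₀ : e₀ ∈ Ico (0 : ℝ) 1) (hle : e₀ ≤ e)
    (hαβ₀ : 0 < 1 + α₀ - β₀) (hβ₀ : 0 < β₀) (hβ : 0 ≤ β)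
    (h1 : β / β₀ * ((1 + e₀) / (1 + e)) < 1)
    (h2 : β * (e - e₀) / (β₀ * (1 + e)) < α - β / β₀ * α₀) {u : Dbar ω} (hu : u ≠ 0) :
    β / β₀ * ((1 + e₀) / (1 + e)) * (⟪(u : L2), A ω α₀ β₀ he₀ u⟫_ℂ).re <
      (⟪(u : L2), A ω α β he u⟫_ℂ).re := by
  set b := β / β₀ with hb
  set s := (1 + e₀) / (1 + e) with hs
  have h3 : 0 < 1 + e := by linarith [he.1]
  have hb0 : 0 ≤ b := by positivity
  have hbβ : b * β₀ = β := by rw [hb]; field_simp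
  -- In this form the second hypothesis says `m > 0`; the bound `r_e ≥ 1/2` then gives the uniform
  -- gap `m / 2`.
  have hmargin : β * (e - e₀) / (β₀ * (1 + e)) = b * (1 - s) := by
    rw [hb, hs]; field_simp; ring
  rw [hmargin] at h2
  set m := α - b * α₀ - b * (1 - s) with hm
  have hm0 : 0 < m := by linarith
  have hu0 : 0 < ‖(u : L2)‖ := norm_pos_iff.2 (by simpa using hu)
  -- The entry for `1 + α - β`. Replacing `s r_{e₀}` by the larger `r_e`, which needs `1 + α₀ - β₀ >
  -- 0`, leaves `m r_e` because `b β₀ = β`.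
  have key : ∀ θ, m / 2 ≤ 1 * (r e θ * (1 + α - β)) - b * s * (r e₀ θ * (1 + α₀ - β₀)) -
      (1 - b * s) * r e θ := by
    intro θ
    have k1 := mul_le_mul_of_nonneg_left (mul_r_le_r he he₀ hle θ) (mul_nonneg hb0 hαβ₀.le)
    have k2 := mul_le_mul_of_nonneg_left (half_le_r he θ) hm0.le
    have k3 : b * (1 + α₀ - β₀) * r e θ = (b * (1 + α₀) - β) * r e θ := by rw [← hbβ]; ring
    rw [k3] at k1
    rw [hm] at k2 ⊢
    linarith
  have := le_re_inner_comb hω (a := 1) (b := b * s) (δ := m / 2) h1.le he he₀ he (α₁ := α)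
    -- The other entry exceeds that of `key` by `2 β (r_e - s r_{e₀}) ≥ 0`.
    (β₁ := β) (α₂ := α₀) (β₂ := β₀) (fun θ => by
      have k1 := mul_le_mul_of_nonneg_left (mul_r_le_r he he₀ hle θ) hβ
      have k4 : β * (s * r e₀ θ) = b * s * (r e₀ θ * β₀) := by rw [← hbβ]; ring
      rw [← hs, k4] at k1
      linarith [key θ]) key u
  have hpos : 0 < m / 2 * ‖(u : L2)‖ ^ 2 := by positivity
  linarith

theorem form_lt_of_gt {α β e α₀ β₀ e₀ : ℝ} (hω : ‖ω‖ = 1)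
    (he : e ∈ Ico (0 : ℝ) 1) (he₀ : e₀ ∈ Ico (0 : ℝ) 1) (hle : e₀ ≤ e)
    (hαβ₀ : 0 < 1 + α₀ - β₀) (hβ₀ : 0 < β₀) (hβ : 0 ≤ β)
    (h1 : 1 < β / β₀ * ((1 - e₀) / (1 - e)))
    (h2 : α - β / β₀ * α₀ < β * (e₀ - e) / (β₀ * (1 - e))) {u : Dbar ω} (hu : u ≠ 0) :
    (⟪(u : L2), A ω α β he u⟫_ℂ).re <
      β / β₀ * ((1 - e₀) / (1 - e)) * (⟪(u : L2), A ω α₀ β₀ he₀ u⟫_ℂ).re := by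
  set b := β / β₀ with hb
  set s := (1 - e₀) / (1 - e) with hs
  have h3 : 0 < 1 - e := by linarith [he.2]
  have hb0 : 0 ≤ b := by positivity
  have hbβ : b * β₀ = β := by rw [hb]; field_simp
  have hmargin : β * (e₀ - e) / (β₀ * (1 - e)) = b * (1 - s) := by
    rw [hb, hs]; field_simp; ring
  rw [hmargin] at h2
  set m := b * (1 - s) - (α - b * α₀) with hm
  have hm0 : 0 < m := by linarith
  have hu0 : 0 < ‖(u : L2)‖ := norm_pos_iff.2 (by simpa using hu)
  have key : ∀ θ, m / 2 ≤ b * s * (r e₀ θ * (1 + α₀ - β₀)) - 1 * (r e θ * (1 + α - β)) -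
      (b * s - 1) * r e θ := by
    intro θ
    have k1 := mul_le_mul_of_nonneg_left (r_le_mul_r he he₀ hle θ) (mul_nonneg hb0 hαβ₀.le)
    have k2 := mul_le_mul_of_nonneg_left (half_le_r he θ) hm0.le
    have k3 : b * (1 + α₀ - β₀) * r e θ = (b * (1 + α₀) - β) * r e θ := by rw [← hbβ]; ring
    rw [k3] at k1
    rw [hm] at k2 ⊢
    linarith
  -- The roles are exchanged, but the Kepler operator split off still has eccentricity `e`, as `key`
  -- compares everything with `r_e`.
  have := le_re_inner_comb hω (a := b * s) (b := 1) (δ := m / 2) h1.le he₀ he he (α₁ := α₀)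
    (β₁ := β₀) (α₂ := α) (β₂ := β) (fun θ => by
      have k1 := mul_le_mul_of_nonneg_left (r_le_mul_r he he₀ hle θ) hβ
      have k4 : β * (s * r e₀ θ) = b * s * (r e₀ θ * β₀) := by rw [← hbβ]; ring
      rw [← hs, k4] at k1
      linarith [key θ]) key u
  have hpos : 0 < m / 2 * ‖(u : L2)‖ ^ 2 := by positivity
  linarith

/-- Only the implication between negative forms is needed: it makes the second form negative on the
negative spectral subspace of `T`. -/
theorem morseIndex_le (hω : ‖ω‖ = 1) (α β : ℝ) {e : ℝ} (he : e ∈ Ico (0 : ℝ) 1)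
    {T : Dbar ω →ₗ[ℂ] L2} (hT : IsSymm T)
    (h : ∀ u : Dbar ω, u ≠ 0 → (⟪(u : L2), T u⟫_ℂ).re < 0 →
      (⟪(u : L2), A ω α β he u⟫_ℂ).re < 0) :
    morseIndex T ≤ morseIndex (A ω α β he) := by
  obtain ⟨K, G, hG, hc⟩ := exists_isResolvent_A hω α β he
  exact hG.toENat_rank_le (isSymm_A hω α β he) hc (negSpace T)
    fun u hu hu0 => h u hu0 (hT.re_inner_neg hu hu0)

end EllipticRE

end

theorem theorem4p5 (α β e α₀ β₀ e₀ : ℝ)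
    (he : e ∈ Set.Ico (0 : ℝ) 1) (he₀ : e₀ ∈ Set.Ico (0 : ℝ) 1) (hle : e₀ ≤ e)
    (hαβ₀ : 0 < 1 + α₀ - β₀) (hα₀ : 0 < α₀) (hβ₀ : 0 < β₀) (hα : 0 < α) (hβ : 0 ≤ β) :
    (β / β₀ * ((1 + e₀) / (1 + e)) < 1 →
      β * (e - e₀) / (β₀ * (1 + e)) < α - β / β₀ * α₀ →
      ∀ ω : ℂ, ‖ω‖ = 1 →
        EllipticRE.StrictlyLess
          (((β / β₀ * ((1 + e₀) / (1 + e)) : ℝ) : ℂ) • EllipticRE.A ω α₀ β₀ he₀)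
          (EllipticRE.A ω α β he) ∧
        EllipticRE.morseIndex (EllipticRE.A ω α β he) ≤
          EllipticRE.morseIndex (EllipticRE.A ω α₀ β₀ he₀)) ∧
    (1 < β / β₀ * ((1 - e₀) / (1 - e)) →
      α - β / β₀ * α₀ < β * (e₀ - e) / (β₀ * (1 - e)) →
      ∀ ω : ℂ, ‖ω‖ = 1 →
        EllipticRE.StrictlyLess
          (EllipticRE.A ω α β he)
          (((β / β₀ * ((1 - e₀) / (1 - e)) : ℝ) : ℂ) • EllipticRE.A ω α₀ β₀ he₀) ∧
        EllipticRE.morseIndex (EllipticRE.A ω α₀ β₀ he₀) ≤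
          EllipticRE.morseIndex (EllipticRE.A ω α β he)) := by
  refine ⟨fun h1 h2 ω hω => ⟨fun u hu => ?_, ?_⟩, fun h1 h2 ω hω => ⟨fun u hu => ?_, ?_⟩⟩
  · have h := EllipticRE.form_lt_of_lt hω he he₀ hle hαβ₀ hβ₀ hβ h1 h2 hu
    rw [LinearMap.sub_apply, LinearMap.smul_apply, inner_sub_right, inner_smul_right,
      Complex.sub_re, Complex.re_ofReal_mul]
    linarith
  · refine EllipticRE.morseIndex_le hω α₀ β₀ he₀ (EllipticRE.isSymm_A hω α β he) fun u hu hneg => ?_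
    have h := EllipticRE.form_lt_of_lt hω he he₀ hle hαβ₀ hβ₀ hβ h1 h2 hu
    -- The factor vanishes when `β = 0`, but nonnegativity suffices: a negative product already
    -- forces the other factor to be negative.
    have hc : 0 ≤ β / β₀ * ((1 + e₀) / (1 + e)) := by
      have := he.1
      have := he₀.1
      positivity
    exact neg_of_mul_neg_right (h.trans hneg) hc
  · have h := EllipticRE.form_lt_of_gt hω he he₀ hle hαβ₀ hβ₀ hβ h1 h2 hu
    rw [LinearMap.sub_apply, LinearMap.smul_apply, inner_sub_right, inner_smul_right,
      Complex.sub_re, Complex.re_ofReal_mul]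
    linarith
  · refine EllipticRE.morseIndex_le hω α β he (EllipticRE.isSymm_A hω α₀ β₀ he₀)
      fun u hu hneg => ?_
    have h := EllipticRE.form_lt_of_gt hω he he₀ hle hαβ₀ hβ₀ hβ h1 h2 hu
    exact h.trans (mul_neg_of_pos_of_neg (zero_lt_one.trans h1) hneg)
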